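/- Let $p$ be a prime, let $v_p$ and $|\cdot|$ be the valuation (with $v_p(p)=1$, $v_p(0)=\infty$) and the absolute value of $\mathbf{C}_p$, and put $\mathcal{O}=\{|x|\le 1\}$, $\mathfrak{m}=\{|x|<1\}$. For a nonzero power series $F=\sum_i F_iX^i\in\mathbf{C}_p[[X]]$ whose coefficients attain the minimum of their valuations, $\mathrm{wideg}(F)$ denotes the smallest index $n$ with $v_p(F_n)=\min_i v_p(F_i)$, and $\mathrm{Lwideg}(F)$ denotes the largest such index, if there is one. All zeros are counted with multiplicity, the multiplicity of $z$ being the largest $k$ such that $(X-z)^k$ divides $F$ in the ring of power series converging on the disc considered. **Open disc.** Let $F,G\in\mathbf{C}_p[[X]]$ be nonzero, converge on $\mathfrak{m}$, and have finite $\mathrm{wideg}(F)=n$ and $\mathrm{wideg}(G)=N$. Then $F$ has finitely many zeros in $\mathfrak{m}$, exactly $n$ counted with multiplicity, so that $$\mathrm{Res}^o(F,G)=F_n^{N}\prod_{z\in\mathfrak{m},\,F(z)=0}G(z)$$ exists. Moreover, for all $n,N\ge 0$ there is one power series $$\Phi\in\mathbf{Z}\big[f_n,f_n^{-1},\{f_k\}_{k>n},\{g_k\}_{k\ge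 0}\big][[f_0,\dots,f_{n-1}]]$$ in independent variables such that for all such $F,G$ with $F_n\in\mathcal{O}^\times$, substituting $f_k=F_k$, $g_k=G_k$ in $\Phi$ gives a convergent sum over the monomials in $f_0,\dots,f_{n-1}$, with sum $\mathrm{Res}^o(F,G)$. **Closed disc.** Every nonzero $F\in\mathbf{C}_p[[X]]$ converging on $\mathcal{O}$ has a finite $\mathrm{Lwideg}(F)$. Let $F,G$ be nonzero and converge on $\mathcal{O}$, with $\mathrm{Lwideg}(F)=m$ and $\mathrm{Lwideg}(G)=M$. Then $F$ has finitely many zeros in $\mathcal{O}$, exactly $m$ counted with multiplicity, so that $$\mathrm{Res}^c(F,G)=F_m^{M}\prod_{z\in\mathcal{O},\,F(z)=0}G(z)$$ exists. Moreover, for all $m,M\ge 0$ there is one power series $\Phi\in\mathbf{Z}[f_m,f_m^{-1},\{f_k\}_{k>m},\{g_k\}_{k\ge0}][[f_0,\dots,f_{m-1}]]$ such that for all such $F,G$ with $F_m\in\mathcal{O}^\times$ the same substitution converges to $\mathrm{Res}^c(F,G)$. **Comparison with distinguished polynomials.** In the open case, a distinguished polynomial of $F$ is a monic polynomial $P$ of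 degree $n$ with lower coefficients in $\mathfrak{m}$ such that $F=F_nPU$ with $U\in\mathcal{O}[[X]]^\times$. In the closed case, it is a monic polynomial $P$ of degree $m$ such that $F=F_mPh$, where $h$ converges on $\mathcal{O}$, has constant coefficient in $\mathcal{O}^\times$, and has all other coefficients in $\mathfrak{m}$. Let $D=\mathfrak{m}$ or $D=\mathcal{O}$, let $F,G$ be as in the corresponding case above, write $n,N$ for their degrees ($\mathrm{wideg}$ or $\mathrm{Lwideg}$ respectively) and $\mathrm{Res}(F,G)$ for the corresponding resultant. Then distinguished polynomials $P$ of $F$ and $Q$ of $G$ exist, and for any such $P,Q$ $$v_p(\mathrm{Res}(F,G))=v_p(\mathrm{Res}(F_nP,G_NQ)),$$ $$\mathrm{Res}(F_nP,G_NQ)=F_n^NG_N^n\prod_{i=1}^{n}\prod_{j=1}^{N}(z_i-w_j)=\det \mathrm{Syl}(F_nP,G_NQ),$$ where $z_1,\dots,z_n$ and $w_1,\dots,w_N$ are the zeros of $F$ and of $G$ in $D$, with multiplicity. If moreover $F,G\in\mathcal{O}[[X]]$, and if it is not the case that $n=N=0$ with both $F_0$ and $G_0$ non-units of $\mathcal{O}$,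 then $$S:=\sup_{x\in D}\min\big(v_p(F(x)),v_p(G(x))\big)\le v_p(\mathrm{Res}(F_nP,G_NQ)).$$ -/

import Mathlib

noncomputable section

namespace PadicResultant

variable {p : ℕ} [Fact p.Prime]

/-- The open unit disc (the maximal ideal of the ring of integers of `ℂ_[p]`). -/
def openDisc (p : ℕ) [Fact p.Prime] : Set ℂ_[p] := {x | ‖x‖ < 1}

/-- The closed unit disc (the ring of integers of `ℂ_[p]`). -/
def closedDisc (p : ℕ) [Fact p.Prime] : Set ℂ_[p] := {x | ‖x‖ ≤ 1}

open Classical in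
/-- The additive `p`-adic valuation on `ℂ_[p]`, normalised by `vp p = 1`, with `vp 0 = ∞`. -/
def vp (x : ℂ_[p]) : EReal := if x = 0 then ⊤ else ((-Real.logb p ‖x‖ : ℝ) : EReal)

/-- The power series `F` converges at every point of `D`. -/
def ConvergesOn (D : Set ℂ_[p]) (F : PowerSeries ℂ_[p]) : Prop :=
  ∀ x ∈ D, Summable fun i : ℕ => PowerSeries.coeff i F * x ^ i

/-- The value of a power series at a point (meaningful where it converges). -/
def evalAt (F : PowerSeries ℂ_[p]) (x : ℂ_[p]) : ℂ_[p] :=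
  ∑' i : ℕ, PowerSeries.coeff i F * x ^ i

/-- `F` has Weierstrass degree `n`: `n` is the smallest index at which the valuation of the
coefficients attains its minimum (and this minimum is finite, that is, `F ≠ 0`). -/
def IsWideg (F : PowerSeries ℂ_[p]) (n : ℕ) : Prop :=
  PowerSeries.coeff n F ≠ 0 ∧
    (∀ i, ‖PowerSeries.coeff i F‖ ≤ ‖PowerSeries.coeff n F‖) ∧
    ∀ i < n, ‖PowerSeries.coeff i F‖ < ‖PowerSeries.coeff n F‖

/-- `F` has closed-disc degree `m`: `m` is the largest index at which the valuation of the
coefficients attains its minimum. -/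
def IsLwideg (F : PowerSeries ℂ_[p]) (m : ℕ) : Prop :=
  PowerSeries.coeff m F ≠ 0 ∧
    (∀ i, ‖PowerSeries.coeff i F‖ ≤ ‖PowerSeries.coeff m F‖) ∧
    ∀ i > m, ‖PowerSeries.coeff i F‖ < ‖PowerSeries.coeff m F‖

/-- The zeros of `F` in `D`. -/
def zeros (D : Set ℂ_[p]) (F : PowerSeries ℂ_[p]) : Set ℂ_[p] :=
  {z | z ∈ D ∧ evalAt F z = 0}

/-- The multiplicity of `z` as a zero of `F`: the largest `k` such that `(X - z) ^ k` divides `F`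
in the ring of power series converging on `D`. -/
def zeroMult (D : Set ℂ_[p]) (F : PowerSeries ℂ_[p]) (z : ℂ_[p]) : ℕ :=
  sSup {k : ℕ | ∃ H : PowerSeries ℂ_[p],
    ConvergesOn D H ∧ F = (PowerSeries.X - PowerSeries.C z) ^ k * H}

/-- The resultant of `F` and `G` over `D`, where `F`, `G` have degrees `n`, `N`: the product of
`(coeff n F) ^ N` and of the values of `G` at the zeros of `F` in `D`, counted with multiplicity. -/
def discResultant (D : Set ℂ_[p]) (n N : ℕ) (F G : PowerSeries ℂ_[p]) : ℂ_[p] :=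
  PowerSeries.coeff n F ^ N * ∏ᶠ z ∈ zeros D F, evalAt G z ^ zeroMult D F z

/-- `Res^o`, the resultant on the open unit disc. -/
def resO (n N : ℕ) (F G : PowerSeries ℂ_[p]) : ℂ_[p] := discResultant (openDisc p) n N F G

/-- `Res^c`, the resultant on the closed unit disc. -/
def resC (m M : ℕ) (F G : PowerSeries ℂ_[p]) : ℂ_[p] := discResultant (closedDisc p) m M F G

/-- The ring `ℤ[f_n, f_n⁻¹, {f_k}_{k > n}, {g_k}_{k ≥ 0}]` in independent variables: `Sum.inl k` is
the variable `f_k` (for `k ≥ n`), `Sum.inr k` is the variable `g_k`. -/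
abbrev UnivCoeff (n : ℕ) : Type :=
  Localization.Away (MvPolynomial.X (Sum.inl ⟨n, le_rfl⟩) :
    MvPolynomial ({k : ℕ // n ≤ k} ⊕ ℕ) ℤ)

/-- The specialisation `f_k ↦ coeff k F`, `g_k ↦ coeff k G` before inverting `f_n`. -/
def specializePoly (n : ℕ) (F G : PowerSeries ℂ_[p]) :
    MvPolynomial ({k : ℕ // n ≤ k} ⊕ ℕ) ℤ →+* ℂ_[p] :=
  MvPolynomial.eval₂Hom (Int.castRingHom ℂ_[p])
    (Sum.elim (fun k => PowerSeries.coeff k.1 F) (fun k => PowerSeries.coeff k G))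

/-- The specialisation `f_k ↦ coeff k F` (`k ≥ n`), `g_k ↦ coeff k G` on `UnivCoeff n`. -/
def specialize (n : ℕ) (F G : PowerSeries ℂ_[p]) (h : PowerSeries.coeff n F ≠ 0) :
    UnivCoeff n →+* ℂ_[p] :=
  Localization.awayLift (specializePoly n F G) _
    (by simpa [specializePoly] using h)

/-- `r` is the value of the power series `Φ` in `n` variables `f_0, …, f_{n-1}` over
`ℤ[f_n, f_n⁻¹, {f_k}_{k > n}, {g_k}]` at the coefficients of `F` and `G`, as a convergent sum. -/
def HasUnivValue (n : ℕ) (Φ : MvPowerSeries (Fin n) (UnivCoeff n)) (F G : PowerSeries ℂ_[p])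
    (h : PowerSeries.coeff n F ≠ 0) (r : ℂ_[p]) : Prop :=
  HasSum (fun a : Fin n →₀ ℕ =>
    specialize n F G h (MvPowerSeries.coeff a Φ) *
      ∏ i : Fin n, PowerSeries.coeff (i : ℕ) F ^ a i) r

/-- `P` is the distinguished polynomial of `F` for the open disc, `n` being the Weierstrass degree:
`P` is monic of degree `n`, its lower coefficients lie in the maximal ideal, and `F = F_n P U`
where `U` is a unit of the ring of power series with integral coefficients. -/
def IsDistinguishedO (F : PowerSeries ℂ_[p]) (n : ℕ) (P : Polynomial ℂ_[p]) : Prop :=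
  P.Monic ∧ P.natDegree = n ∧ (∀ i < n, ‖P.coeff i‖ < 1) ∧
    ∃ U : PowerSeries ℂ_[p],
      ‖PowerSeries.coeff 0 U‖ = 1 ∧ (∀ i, ‖PowerSeries.coeff i U‖ ≤ 1) ∧
      F = PowerSeries.C (PowerSeries.coeff n F) * (P : PowerSeries ℂ_[p]) * U

/-- `P` is the distinguished polynomial of `F` for the closed disc, `m` being the closed-disc
degree: `P` is monic of degree `m` and `F = F_m P h` where `h` converges on the closed disc, has a
unit as its constant coefficient and has all its other coefficients in the maximal ideal (so that
`h` has no zero on the closed disc). -/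
def IsDistinguishedC (F : PowerSeries ℂ_[p]) (m : ℕ) (P : Polynomial ℂ_[p]) : Prop :=
  P.Monic ∧ P.natDegree = m ∧
    ∃ h : PowerSeries ℂ_[p],
      ConvergesOn (closedDisc p) h ∧
      ‖PowerSeries.coeff 0 h‖ = 1 ∧ (∀ i > 0, ‖PowerSeries.coeff i h‖ < 1) ∧
      F = PowerSeries.C (PowerSeries.coeff m F) * (P : PowerSeries ℂ_[p]) * h

/-- All coefficients of `F` lie in the ring of integers of `ℂ_[p]`. -/
def HasIntegralCoeffs (F : PowerSeries ℂ_[p]) : Prop := ∀ i, ‖PowerSeries.coeff i F‖ ≤ 1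

/-- The resultant over `D` exists: `F` has finitely many zeros in `D`, with finite positive
multiplicities (an infinite multiplicity would be recorded as `0`) of sum `n`, and `G` converges at
each of them. -/
def ResultantExists (D : Set ℂ_[p]) (n : ℕ) (F G : PowerSeries ℂ_[p]) : Prop :=
  (zeros D F).Finite ∧ (∀ z ∈ zeros D F, 1 ≤ zeroMult D F z) ∧
    ∑ᶠ z ∈ zeros D F, zeroMult D F z = n ∧
    ∀ z ∈ zeros D F, Summable fun i : ℕ => PowerSeries.coeff i G * z ^ i

/-- `S`: the supremum over `x` in `D` of `min (vp (F x)) (vp (G x))`. -/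
def supMin (D : Set ℂ_[p]) (F G : PowerSeries ℂ_[p]) : EReal :=
  ⨆ x ∈ D, min (vp (evalAt F x)) (vp (evalAt G x))

/-- What is claimed about the resultant `r` over `D` of `F` and `G` (of degrees `n` and `N`) and
the polynomials `f = F_n P` and `g = G_N Q`: equality of valuations, the product formula for the
Sylvester determinant, and the bound for `S`. -/
def ResultantComparison (D : Set ℂ_[p]) (n N : ℕ) (F G : PowerSeries ℂ_[p]) (r : ℂ_[p])
    (f g : Polynomial ℂ_[p]) : Prop :=
  vp r = vp (f.resultant g) ∧
  f.resultant g = PowerSeries.coeff n F ^ N * PowerSeries.coeff N G ^ n *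
    ∏ᶠ z ∈ zeros D F, ∏ᶠ w ∈ zeros D G, (z - w) ^ (zeroMult D F z * zeroMult D G w) ∧
  f.resultant g = (f.sylvester g n N).det ∧
  (HasIntegralCoeffs F → HasIntegralCoeffs G →
    ¬ (n = 0 ∧ N = 0 ∧ ‖PowerSeries.coeff n F‖ < 1 ∧ ‖PowerSeries.coeff N G‖ < 1) →
    supMin D F G ≤ vp (f.resultant g))

end PadicResultant

end

open PadicResultant

/-! Take the lower coefficients `f_0, …, f_{n-1}` of `F` as formal variables. The generic series
`∑ f_i X ^ i`, with `f_n` invertible, is the product of a monic polynomial and a unit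
over the ring of formal power series in these variables: the inverse of the unit is found by a
recursion that is triangular for the order by degree in the variables. The remainder of `G` modulo
the polynomial also makes sense formally, and the universal power series is the resultant of the
polynomial and this remainder, as `G` and the remainder take the same values at the roots.

To evaluate at actual coefficients, give `f_i` the weight `n - i`. By homogeneity a coefficient of
weight `w` in the factorisation is bounded by `ω w`, where the gauge `ω` is a decreasing
supermultiplicative function bounding the coefficients of `F` of index at least `n`: a constant on
the open disc, a function tending to `0` on the closed disc. The polynomial then becomes a
distinguished polynomial `P` of `F`.

Finally `F / (F_n P)` has absolute value `1` on the disc, so that the zeros of `F`, their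
multiplicities and the absolute values of `F` on the disc are those of the polynomial `F_n P`. -/

noncomputable section

namespace PadicResultant

open Filter Topology Finset

section Evaluation

variable {K : Type*} [NormedField K] {σ : Type*} [Fintype σ]

/-- The value at `x` of the monomial with exponent `a`. -/
def monomialValue (x : σ → K) (a : σ →₀ ℕ) : K := ∏ i, x i ^ a i

theorem monomialValue_zero (x : σ → K) : monomialValue x 0 = 1 := by simp [monomialValue]

theorem monomialValue_add (x : σ → K) (a b : σ →₀ ℕ) :
    monomialValue x (a + b) = monomialValue x a * monomialValue x b := by
  simp [monomialValue, pow_add, Finset.prod_mul_distrib]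

theorem norm_monomialValue_le_pow {x : σ → K} {r : ℝ} (hx : ∀ i, ‖x i‖ ≤ r) (a : σ →₀ ℕ) :
    ‖monomialValue x a‖ ≤ r ^ a.degree := by
  rw [monomialValue, norm_prod, Finsupp.degree_eq_sum, ← Finset.prod_pow_eq_pow_sum]
  refine Finset.prod_le_prod (fun _ _ => norm_nonneg _) fun i _ => ?_
  rw [norm_pow]
  gcongr
  exact hx i

/-- The series `Ψ` in several variables converges at the point `x`. -/
def ConvergesAt (x : σ → K) (Ψ : MvPowerSeries σ K) : Prop :=
  Summable fun a => MvPowerSeries.coeff a Ψ * monomialValue x a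

/-- The value at `x` of a power series in several variables (`0` where it does not converge). -/
def mvEval (x : σ → K) (Ψ : MvPowerSeries σ K) : K :=
  ∑' a, MvPowerSeries.coeff a Ψ * monomialValue x a

theorem hasSum_mvEval_C (x : σ → K) (c : K) :
    HasSum (fun a => MvPowerSeries.coeff a (MvPowerSeries.C c : MvPowerSeries σ K) *
      monomialValue x a) c := by
  classical
  convert hasSum_ite_eq (0 : σ →₀ ℕ) c using 2 with a
  rw [MvPowerSeries.coeff_C]
  split_ifs with h
  · rw [h, monomialValue_zero, mul_one]
  · rw [zero_mul]

theorem mvEval_X (x : σ → K) (i : σ) : mvEval x (MvPowerSeries.X i) = x i := by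
  classical
  rw [mvEval, tsum_eq_single (Finsupp.single i 1)]
  · rw [MvPowerSeries.coeff_X, if_pos rfl, one_mul, monomialValue, Fintype.prod_eq_single i]
    · simp
    · intro j hj
      simp [Finsupp.single_eq_of_ne hj]
  · intro a ha
    rw [MvPowerSeries.coeff_X, if_neg ha, zero_mul]

theorem mvEval_zero (x : σ → K) : mvEval x 0 = 0 := by simp [mvEval]

theorem mvEval_C (x : σ → K) (c : K) : mvEval x (MvPowerSeries.C c) = c :=
  (hasSum_mvEval_C x c).tsum_eq

/-- Evaluation at `x` of the coefficients of a polynomial over a ring of power series. -/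
def mvEvalPoly (x : σ → K) (P : Polynomial (MvPowerSeries σ K)) : Polynomial K :=
  ∑ i ∈ range (P.natDegree + 1), Polynomial.monomial i (mvEval x (P.coeff i))

@[simp] theorem coeff_mvEvalPoly (x : σ → K) (P : Polynomial (MvPowerSeries σ K)) (i : ℕ) :
    (mvEvalPoly x P).coeff i = mvEval x (P.coeff i) := by
  simp only [mvEvalPoly, Polynomial.finsetSum_coeff, Polynomial.coeff_monomial, sum_ite_eq',
    mem_range]
  split_ifs with h
  · rfl
  · rw [Polynomial.coeff_eq_zero_of_natDegree_lt (by omega), mvEval_zero]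

theorem isMonicOfDegree_mvEvalPoly (x : σ → K) {P : Polynomial (MvPowerSeries σ K)} {n : ℕ}
    (hP : P.IsMonicOfDegree n) : (mvEvalPoly x P).IsMonicOfDegree n := by
  rw [Polynomial.isMonicOfDegree_iff, Polynomial.natDegree_le_iff_coeff_eq_zero] at hP ⊢
  refine ⟨fun i hi => ?_, ?_⟩
  · rw [coeff_mvEvalPoly, hP.1 i hi, mvEval_zero]
  · rw [coeff_mvEvalPoly, hP.2, ← map_one MvPowerSeries.C, mvEval_C]

theorem mvEvalPoly_X_pow (x : σ → K) (k : ℕ) :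
    mvEvalPoly x (Polynomial.X ^ k) = Polynomial.X ^ k := by
  ext i
  rw [coeff_mvEvalPoly, Polynomial.coeff_X_pow, Polynomial.coeff_X_pow]
  split_ifs
  · rw [← map_one MvPowerSeries.C, mvEval_C]
  · exact mvEval_zero x

/-- Evaluation at `x` of the coefficients of a power series over a ring of power series. -/
def mvEvalSeries (x : σ → K) (S : PowerSeries (MvPowerSeries σ K)) : PowerSeries K :=
  PowerSeries.mk fun i => mvEval x (PowerSeries.coeff i S)

theorem mvEvalSeries_coe (x : σ → K) (P : Polynomial (MvPowerSeries σ K)) :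
    mvEvalSeries x (P : PowerSeries (MvPowerSeries σ K)) = (mvEvalPoly x P : PowerSeries K) := by
  ext i
  simp [mvEvalSeries]

variable [IsUltrametricDist K]

instance nonarchimedeanRing_of_isUltrametricDist : NonarchimedeanRing K where
  is_nonarchimedean := NonarchimedeanAddGroup.is_nonarchimedean

theorem norm_sub_le_max (x y : K) : ‖x - y‖ ≤ max ‖x‖ ‖y‖ := by
  simpa [sub_eq_add_neg] using IsUltrametricDist.norm_add_le_max x (-y)

theorem hasSum_sum_antidiagonal_mul {ι : Type*} [AddCommMonoid ι] [HasAntidiagonal ι]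
    {f g : ι → K} (hf : Summable f) (hg : Summable g) :
    HasSum (fun a => ∑ x ∈ antidiagonal a, f x.1 * g x.2) ((∑' a, f a) * ∑' a, g a) := by
  have h := hf.mul_of_nonarchimedean hg
  rw [hf.tsum_mul_tsum_eq_tsum_sum_antidiagonal hg h]
  exact (summable_sum_mul_antidiagonal_of_summable_mul h).hasSum

theorem hasSum_coeff_mul_mul_pow {F G : PowerSeries K} {x : K}
    (hF : Summable fun i => PowerSeries.coeff i F * x ^ i)
    (hG : Summable fun i => PowerSeries.coeff i G * x ^ i) :
    HasSum (fun i => PowerSeries.coeff i (F * G) * x ^ i)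
      ((∑' i, PowerSeries.coeff i F * x ^ i) * ∑' i, PowerSeries.coeff i G * x ^ i) := by
  convert hasSum_sum_antidiagonal_mul hF hG using 2 with i
  rw [PowerSeries.coeff_mul, Finset.sum_mul]
  refine Finset.sum_congr rfl fun y hy => ?_
  rw [← mem_antidiagonal.mp hy, pow_add]
  ring

theorem hasSum_mvEval_mul {x : σ → K} {Ψ Θ : MvPowerSeries σ K} (hΨ : ConvergesAt x Ψ)
    (hΘ : ConvergesAt x Θ) :
    HasSum (fun a => MvPowerSeries.coeff a (Ψ * Θ) * monomialValue x a)
      (mvEval x Ψ * mvEval x Θ) := by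
  classical
  unfold mvEval
  convert hasSum_sum_antidiagonal_mul hΨ hΘ using 2 with a
  rw [MvPowerSeries.coeff_mul, Finset.sum_mul]
  refine Finset.sum_congr rfl fun y hy => ?_
  rw [← mem_antidiagonal.mp hy, monomialValue_add]
  ring

theorem norm_mvEval_le {x : σ → K} {Ψ : MvPowerSeries σ K} {c : ℝ} (hc : 0 ≤ c)
    (h : ∀ a, ‖MvPowerSeries.coeff a Ψ‖ * ‖monomialValue x a‖ ≤ c) : ‖mvEval x Ψ‖ ≤ c :=
  IsUltrametricDist.norm_tsum_le_of_forall_le_of_nonneg hc fun a => by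
    rw [norm_mul]
    exact h a

/-- The subring of the power series that converge at `x`. -/
def convergentSubring (x : σ → K) : Subring (MvPowerSeries σ K) where
  carrier := {Ψ | ConvergesAt x Ψ}
  mul_mem' hΨ hΘ := (hasSum_mvEval_mul hΨ hΘ).summable
  one_mem' := by simpa [ConvergesAt] using (hasSum_mvEval_C x (1 : K)).summable
  zero_mem' := by simp [ConvergesAt]
  add_mem' hΨ hΘ := by simpa [ConvergesAt, add_mul] using hΨ.add hΘ
  neg_mem' hΨ := by simpa [ConvergesAt] using hΨ.neg

/-- Evaluation at `x` of the power series that converge there. -/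
def mvEvalHom (x : σ → K) : convergentSubring x →+* K where
  toFun Ψ := mvEval x Ψ.1
  map_one' := by simpa [mvEval] using (hasSum_mvEval_C x (1 : K)).tsum_eq
  map_zero' := mvEval_zero x
  map_mul' Ψ Θ := (hasSum_mvEval_mul Ψ.2 Θ.2).tsum_eq
  map_add' Ψ Θ := by
    have h := Summable.tsum_add (f := fun a => MvPowerSeries.coeff a Ψ.1 * monomialValue x a)
      (g := fun a => MvPowerSeries.coeff a Θ.1 * monomialValue x a) Ψ.2 Θ.2
    simpa [mvEval, add_mul] using h

@[simp] theorem mvEvalHom_apply (x : σ → K) (Ψ : convergentSubring x) :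
    mvEvalHom x Ψ = mvEval x Ψ.1 := rfl

theorem mvEvalSeries_mul {x : σ → K} {S T : PowerSeries (MvPowerSeries σ K)}
    (hS : ∀ i, ConvergesAt x (PowerSeries.coeff i S))
    (hT : ∀ i, ConvergesAt x (PowerSeries.coeff i T)) :
    mvEvalSeries x (S * T) = mvEvalSeries x S * mvEvalSeries x T := by
  have lift {U : PowerSeries (MvPowerSeries σ K)}
      (hU : ∀ i, ConvergesAt x (PowerSeries.coeff i U)) :
      ∃ U' : PowerSeries (convergentSubring x), U'.map (convergentSubring x).subtype = U :=
    ⟨.mk fun i => ⟨_, hU i⟩, by ext; simp⟩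
  have eval_map (U : PowerSeries (convergentSubring x)) :
      mvEvalSeries x (U.map (convergentSubring x).subtype) = U.map (mvEvalHom x) := by
    ext i
    simp [mvEvalSeries]
  obtain ⟨S, rfl⟩ := lift hS
  obtain ⟨T, rfl⟩ := lift hT
  rw [← map_mul, eval_map, eval_map, eval_map, map_mul]

theorem mvEvalPoly_map_subtype {x : σ → K} (P : Polynomial (convergentSubring x)) :
    mvEvalPoly x (P.map (convergentSubring x).subtype) = P.map (mvEvalHom x) := by
  ext i
  simp

theorem exists_map_subtype_eq {x : σ → K} {P : Polynomial (MvPowerSeries σ K)}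
    (hP : ∀ i, ConvergesAt x (P.coeff i)) :
    ∃ P' : Polynomial (convergentSubring x), P'.map (convergentSubring x).subtype = P :=
  (Polynomial.mem_lifts _).mp <|
    (Polynomial.lifts_iff_coeff_lifts _).mpr fun i => ⟨⟨_, hP i⟩, rfl⟩

theorem mvEvalPoly_modByMonic {x : σ → K} {P Q : Polynomial (MvPowerSeries σ K)} (hQ : Q.Monic)
    (hPx : ∀ i, ConvergesAt x (P.coeff i)) (hQx : ∀ i, ConvergesAt x (Q.coeff i)) :
    mvEvalPoly x (P %ₘ Q) = mvEvalPoly x P %ₘ mvEvalPoly x Q := by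
  obtain ⟨P, rfl⟩ := exists_map_subtype_eq hPx
  obtain ⟨Q, rfl⟩ := exists_map_subtype_eq hQx
  have hQ' : Q.Monic :=
    Polynomial.monic_of_injective (convergentSubring x).subtype_injective hQ
  simp only [← Polynomial.map_modByMonic _ hQ', mvEvalPoly_map_subtype]

theorem hasSum_mvEval_resultant {x : σ → K} {P Q : Polynomial (MvPowerSeries σ K)} (m n : ℕ)
    (hPx : ∀ i, ConvergesAt x (P.coeff i)) (hQx : ∀ i, ConvergesAt x (Q.coeff i)) :
    HasSum (fun a => MvPowerSeries.coeff a (P.resultant Q m n) * monomialValue x a)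
      ((mvEvalPoly x P).resultant (mvEvalPoly x Q) m n) := by
  obtain ⟨P, rfl⟩ := exists_map_subtype_eq hPx
  obtain ⟨Q, rfl⟩ := exists_map_subtype_eq hQx
  rw [mvEvalPoly_map_subtype, mvEvalPoly_map_subtype, Polynomial.resultant_map_map,
    Polynomial.resultant_map_map]
  exact (P.resultant Q m n).2.hasSum

end Evaluation

section FormalFactorization

variable {σ A : Type*} [CommRing A]

/-- The coefficients of a power series over `MvPowerSeries σ A`, indexed by an exponent `a` and an
index `i`, are ordered by the degree of `a` first. Multiplication by a series whose coefficients of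
index `< n` have no constant term is triangular for this order: `lowerTerms n a i` lists the terms
of the coefficient `(a, i + n)` of a product which involve coefficients of the first factor lower
than `(a, i)`. -/
def lowerTerms [DecidableEq σ] (n : ℕ) (a : σ →₀ ℕ) (i : ℕ) :
    Finset ((ℕ × ℕ) × (σ →₀ ℕ) × (σ →₀ ℕ)) :=
  {t ∈ antidiagonal (i + n) ×ˢ antidiagonal a |
    toLex (t.2.1.degree, t.1.1) < toLex (a.degree, i)}

theorem coeff_coeff_mul_eq_add_sum_lowerTerms [DecidableEq σ] {n : ℕ}
    {S : PowerSeries (MvPowerSeries σ A)}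
    (hS : ∀ l < n, MvPowerSeries.constantCoeff (PowerSeries.coeff l S) = 0)
    (q : PowerSeries (MvPowerSeries σ A)) (a : σ →₀ ℕ) (i : ℕ) :
    MvPowerSeries.coeff a (PowerSeries.coeff (i + n) (q * S)) =
      MvPowerSeries.coeff a (PowerSeries.coeff i q) *
          MvPowerSeries.constantCoeff (PowerSeries.coeff n S) +
        ∑ t ∈ lowerTerms n a i, MvPowerSeries.coeff t.2.1 (PowerSeries.coeff t.1.1 q) *
          MvPowerSeries.coeff t.2.2 (PowerSeries.coeff t.1.2 S) := by
  simp only [PowerSeries.coeff_mul, map_sum, MvPowerSeries.coeff_mul]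
  rw [← sum_product', ← sum_filter_not_add_sum_filter _
    (fun t => toLex (t.2.1.degree, t.1.1) < toLex (a.degree, i))]
  refine congrArg (· + _) (sum_eq_single_of_mem ((i, n), (a, 0)) (by simp) ?_)
  rintro ⟨⟨j, l⟩, b, c⟩ ht hne
  simp only [mem_filter, mem_product, HasAntidiagonal.mem_antidiagonal, Prod.Lex.toLex_lt_toLex,
    not_or, not_and, not_lt] at ht
  obtain ⟨⟨hjl, hbc⟩, hle, hlt⟩ := ht
  have hc : c = 0 := by
    have h : b.degree + c.degree = a.degree := by rw [← map_add, hbc]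
    exact (Finsupp.degree_eq_zero_iff c).mp (by omega)
  subst hc
  rw [add_zero] at hbc
  subst hbc
  have hl : l < n := by
    refine lt_of_le_of_ne (by have := hlt rfl; omega) ?_
    rintro rfl
    exact hne (by simpa using hjl)
  change _ * MvPowerSeries.constantCoeff (PowerSeries.coeff l S) = 0
  rw [hS l hl, mul_zero]

theorem constantCoeff_coeff_mul {n : ℕ} {S : PowerSeries (MvPowerSeries σ A)}
    (hS : ∀ l < n, MvPowerSeries.constantCoeff (PowerSeries.coeff l S) = 0)
    (q : PowerSeries (MvPowerSeries σ A)) :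
    MvPowerSeries.constantCoeff (PowerSeries.coeff n (q * S)) =
      MvPowerSeries.constantCoeff (PowerSeries.coeff 0 q) *
        MvPowerSeries.constantCoeff (PowerSeries.coeff n S) := by
  classical
  have h := coeff_coeff_mul_eq_add_sum_lowerTerms hS q 0 0
  have hlow : lowerTerms n (0 : σ →₀ ℕ) 0 = ∅ := by
    simp [lowerTerms, Prod.Lex.toLex_lt_toLex]
  rwa [hlow, sum_empty, add_zero, zero_add] at h

theorem exists_coeff_mul_eq {n : ℕ} {S : PowerSeries (MvPowerSeries σ A)}
    (hS : ∀ l < n, MvPowerSeries.constantCoeff (PowerSeries.coeff l S) = 0)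
    (hu : IsUnit (MvPowerSeries.constantCoeff (PowerSeries.coeff n S)))
    (T : PowerSeries (MvPowerSeries σ A)) :
    ∃ q : PowerSeries (MvPowerSeries σ A), ∀ i,
      PowerSeries.coeff (i + n) (q * S) = PowerSeries.coeff i T := by
  classical
  obtain ⟨u, hu⟩ := hu
  let rank : (σ →₀ ℕ) × ℕ → ℕ ×ₗ ℕ := fun x => toLex (x.1.degree, x.2)
  let q : (σ →₀ ℕ) × ℕ → A := (InvImage.wf rank wellFounded_lt).fix fun x ih =>
    ↑u⁻¹ * (MvPowerSeries.coeff x.1 (PowerSeries.coeff x.2 T) -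
      ∑ t ∈ (lowerTerms n x.1 x.2).attach,
        ih (t.1.2.1, t.1.1.1) (mem_filter.mp t.2).2 *
          MvPowerSeries.coeff t.1.2.2 (PowerSeries.coeff t.1.1.2 S))
  have hq (a i) : q (a, i) = ↑u⁻¹ * (MvPowerSeries.coeff a (PowerSeries.coeff i T) -
      ∑ t ∈ lowerTerms n a i, q (t.2.1, t.1.1) *
        MvPowerSeries.coeff t.2.2 (PowerSeries.coeff t.1.2 S)) := by
    rw [← sum_attach (lowerTerms n a i)]
    exact WellFounded.fix_eq _ _ _
  let coeffs : ℕ → MvPowerSeries σ A := fun i a => q (a, i)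
  have hcoeff (b : σ →₀ ℕ) (j : ℕ) :
      MvPowerSeries.coeff b (PowerSeries.coeff j (.mk coeffs)) = q (b, j) := by
    rw [PowerSeries.coeff_mk]
    rfl
  refine ⟨.mk coeffs, fun i => MvPowerSeries.ext fun a => ?_⟩
  rw [coeff_coeff_mul_eq_add_sum_lowerTerms hS]
  simp only [hcoeff]
  rw [hq a i, ← hu, mul_comm, Units.mul_inv_cancel_left, sub_add_cancel]

/-- The series `∑_{i < n} f_i X^i + ∑_{k ≥ 0} f k X^(n + k)` whose coefficients `f_0, …, f_{n-1}` of
index `< n` are independent variables. The sequence `f` is indexed from the coefficient `n` on. -/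
def genericSeries (n : ℕ) (f : ℕ → A) : PowerSeries (MvPowerSeries (Fin n) A) :=
  .mk fun i => if h : i < n then MvPowerSeries.X ⟨i, h⟩ else MvPowerSeries.C (f (i - n))

theorem coeff_genericSeries_of_lt {n i : ℕ} (f : ℕ → A) (h : i < n) :
    PowerSeries.coeff i (genericSeries n f) = MvPowerSeries.X ⟨i, h⟩ := by
  rw [genericSeries, PowerSeries.coeff_mk, dif_pos h]

theorem coeff_add_genericSeries (n : ℕ) (f : ℕ → A) (k : ℕ) :
    PowerSeries.coeff (n + k) (genericSeries n f) = MvPowerSeries.C (f k) := by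
  rw [genericSeries, PowerSeries.coeff_mk, dif_neg (by omega), Nat.add_sub_cancel_left]

theorem constantCoeff_coeff_genericSeries_of_lt {n i : ℕ} (f : ℕ → A) (h : i < n) :
    MvPowerSeries.constantCoeff (PowerSeries.coeff i (genericSeries n f)) = 0 := by
  rw [coeff_genericSeries_of_lt f h, MvPowerSeries.constantCoeff_X]

theorem constantCoeff_coeff_genericSeries_self (n : ℕ) (f : ℕ → A) :
    MvPowerSeries.constantCoeff (PowerSeries.coeff n (genericSeries n f)) = f 0 := by
  rw [← MvPowerSeries.constantCoeff_C (σ := Fin n) (f 0), ← coeff_add_genericSeries, add_zero]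

/-- A factorisation of `genericSeries n f` as a monic polynomial `poly` of degree `n` times the
series `unit`, together with the inverse `inv` of `unit`. -/
structure WeierstrassFactorization (n : ℕ) (f : ℕ → A) where
  poly : Polynomial (MvPowerSeries (Fin n) A)
  unit : PowerSeries (MvPowerSeries (Fin n) A)
  inv : PowerSeries (MvPowerSeries (Fin n) A)
  isMonicOfDegree : poly.IsMonicOfDegree n
  inv_mul_genericSeries : inv * genericSeries n f = poly
  unit_mul_inv : unit * inv = 1

namespace WeierstrassFactorization

theorem nonempty [Nontrivial A] (n : ℕ) {f : ℕ → A} (hf : IsUnit (f 0)) :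
    Nonempty (WeierstrassFactorization n f) := by
  obtain ⟨q, hq⟩ := exists_coeff_mul_eq (S := genericSeries n f)
    (fun l hl => constantCoeff_coeff_genericSeries_of_lt f hl)
    (by rwa [constantCoeff_coeff_genericSeries_self]) 1
  have hunit : IsUnit q := by
    have h := constantCoeff_coeff_mul
      (fun l hl => constantCoeff_coeff_genericSeries_of_lt f hl) q
    have h0 := hq 0
    rw [zero_add] at h0
    rw [h0, constantCoeff_coeff_genericSeries_self] at h
    rw [PowerSeries.isUnit_iff_constantCoeff, MvPowerSeries.isUnit_iff_constantCoeff]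
    exact IsUnit.of_mul_eq_one (f 0) (by simpa using h.symm)
  obtain ⟨u, rfl⟩ := hunit
  have hpoly : ((PowerSeries.trunc (n + 1) (u * genericSeries n f) :
      Polynomial (MvPowerSeries (Fin n) A)) : PowerSeries (MvPowerSeries (Fin n) A)) =
        u * genericSeries n f := by
    ext1 i
    rw [Polynomial.coeff_coe, PowerSeries.coeff_trunc]
    split_ifs with hi
    · rfl
    · obtain ⟨k, rfl⟩ := Nat.exists_eq_add_of_le' (show n ≤ i by omega)
      rw [hq, PowerSeries.coeff_one, if_neg (by omega)]
  refine ⟨⟨PowerSeries.trunc (n + 1) (u * genericSeries n f), ↑u⁻¹, u, ?_, hpoly.symm, by simp⟩⟩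
  rw [Polynomial.isMonicOfDegree_iff]
  refine ⟨Nat.le_of_lt_succ (PowerSeries.natDegree_trunc_lt _ _), ?_⟩
  rw [PowerSeries.coeff_trunc, if_pos n.lt_succ_self]
  simpa using hq 0

variable {n : ℕ} {f : ℕ → A}

theorem poly_mul_unit (d : WeierstrassFactorization n f) :
    (d.poly : PowerSeries (MvPowerSeries (Fin n) A)) * d.unit = genericSeries n f := by
  rw [← d.inv_mul_genericSeries, mul_right_comm, mul_comm d.inv, d.unit_mul_inv, one_mul]

theorem coeff_add_inv_mul_genericSeries (d : WeierstrassFactorization n f) (i : ℕ) :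
    PowerSeries.coeff (i + n) (d.inv * genericSeries n f) =
      PowerSeries.coeff i (1 : PowerSeries (MvPowerSeries (Fin n) A)) := by
  rw [d.inv_mul_genericSeries, Polynomial.coeff_coe, PowerSeries.coeff_one]
  split_ifs with h
  · rw [h, zero_add]
    simpa only [d.isMonicOfDegree.natDegree_eq] using d.isMonicOfDegree.monic.coeff_natDegree
  · exact Polynomial.coeff_eq_zero_of_natDegree_lt
      (d.isMonicOfDegree.natDegree_eq.trans_lt (by omega))

theorem constantCoeff_coeff_zero_inv_mul (d : WeierstrassFactorization n f) :
    MvPowerSeries.constantCoeff (PowerSeries.coeff 0 d.inv) * f 0 = 1 := by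
  have h := constantCoeff_coeff_mul
    (fun l hl => constantCoeff_coeff_genericSeries_of_lt f hl) d.inv
  have h0 := d.coeff_add_inv_mul_genericSeries 0
  rw [zero_add] at h0
  rw [h0, constantCoeff_coeff_genericSeries_self] at h
  simpa using h.symm

/-- The image of a factorisation under a ring homomorphism of the coefficients. -/
def map {B : Type*} [CommRing B] [Nontrivial B] (d : WeierstrassFactorization n f) (φ : A →+* B) :
    WeierstrassFactorization n fun k => φ (f k) where
  poly := d.poly.map (MvPowerSeries.map φ)
  unit := d.unit.map (MvPowerSeries.map φ)
  inv := d.inv.map (MvPowerSeries.map φ)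
  isMonicOfDegree :=
    ⟨(d.isMonicOfDegree.monic.natDegree_map _).trans d.isMonicOfDegree.natDegree_eq,
      d.isMonicOfDegree.monic.map _⟩
  inv_mul_genericSeries := by
    have h : genericSeries n (fun k => φ (f k)) =
        (genericSeries n f).map (MvPowerSeries.map φ) := by
      ext1 i
      simp only [genericSeries, PowerSeries.coeff_map, PowerSeries.coeff_mk]
      split_ifs <;> simp
    rw [h, ← map_mul, d.inv_mul_genericSeries, Polynomial.polynomial_map_coe]
  unit_mul_inv := by rw [← map_mul, d.unit_mul_inv, map_one]

end WeierstrassFactorization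

end FormalFactorization

section Weights

variable {n : ℕ}

/-- The weight of a monomial, the variable of index `i` having weight `n - i`. It makes
`genericSeries n f` isobaric when `f k` has weight `-k`. -/
def wt (a : Fin n →₀ ℕ) : ℕ := ∑ i, a i * (n - i)

@[simp] theorem wt_zero : wt (0 : Fin n →₀ ℕ) = 0 := by simp [wt]

theorem wt_add (a b : Fin n →₀ ℕ) : wt (a + b) = wt a + wt b := by
  simp [wt, add_mul, Finset.sum_add_distrib]

theorem wt_single (i : Fin n) : wt (Finsupp.single i 1) = n - i := by
  rw [wt, Fintype.sum_eq_single i]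
  · simp
  · intro j hj
    simp [Finsupp.single_eq_of_ne hj]

theorem degree_le_wt (a : Fin n →₀ ℕ) : a.degree ≤ wt a := by
  rw [Finsupp.degree_eq_sum, wt]
  exact Finset.sum_le_sum fun i _ => Nat.le_mul_of_pos_right _ (Nat.sub_pos_of_lt i.2)

/-- A gauge for the decay of coefficients with the weight: it vanishes in negative weights, and it
is decreasing and supermultiplicative in nonnegative ones. -/
structure IsGauge (ω : ℤ → ℝ) : Prop where
  eq_zero : ∀ w < 0, ω w = 0
  zero_eq : ω 0 = 1
  nonneg : ∀ w, 0 ≤ ω w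
  anti : ∀ v w, 0 ≤ v → v ≤ w → ω w ≤ ω v
  mul_le_of_nonneg : ∀ v w, 0 ≤ v → 0 ≤ w → ω v * ω w ≤ ω (v + w)

namespace IsGauge

variable {ω : ℤ → ℝ}

theorem mul_le (h : IsGauge ω) (v w : ℤ) : ω v * ω w ≤ ω (v + w) := by
  rcases lt_or_ge v 0 with hv | hv
  · simpa only [h.eq_zero v hv, zero_mul] using h.nonneg _
  rcases lt_or_ge w 0 with hw | hw
  · simpa only [h.eq_zero w hw, mul_zero] using h.nonneg _
  exact h.mul_le_of_nonneg v w hv hw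

theorem le_one (h : IsGauge ω) (w : ℤ) : ω w ≤ 1 := by
  rcases lt_or_ge w 0 with hw | hw
  · exact (h.eq_zero w hw).trans_le zero_le_one
  · exact h.zero_eq ▸ h.anti 0 w le_rfl hw

end IsGauge

variable {K : Type*} [NormedField K] {ω : ℤ → ℝ}

/-- The coefficient of each monomial `a` of `Ψ` is bounded by the gauge `ω` at `wt a + d`. -/
def WeightBounded (ω : ℤ → ℝ) (d : ℤ) (Ψ : MvPowerSeries (Fin n) K) : Prop :=
  ∀ a, ‖MvPowerSeries.coeff a Ψ‖ ≤ ω (wt a + d)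

/-- The coefficient of index `i` of `S` is bounded by the gauge `ω` with shift `i + d`. -/
def SeriesBounded (ω : ℤ → ℝ) (d : ℤ) (S : PowerSeries (MvPowerSeries (Fin n) K)) : Prop :=
  ∀ i : ℕ, WeightBounded ω (i + d) (PowerSeries.coeff i S)

namespace WeightBounded

theorem zero (hω : IsGauge ω) (d : ℤ) :
    WeightBounded ω d (0 : MvPowerSeries (Fin n) K) := fun a => by
  simpa using hω.nonneg _

theorem C (hω : IsGauge ω) {d : ℤ} {c : K} (hc : ‖c‖ ≤ ω d) :
    WeightBounded ω d (MvPowerSeries.C c : MvPowerSeries (Fin n) K) := fun a => by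
  classical
  rw [MvPowerSeries.coeff_C]
  split_ifs with h
  · simpa [h] using hc
  · simpa using hω.nonneg _

theorem one (hω : IsGauge ω) : WeightBounded ω 0 (1 : MvPowerSeries (Fin n) K) := by
  simpa using C (n := n) hω (d := 0) (c := (1 : K)) (by simp [hω.zero_eq])

theorem X (hω : IsGauge ω) (i : Fin n) :
    WeightBounded ω (i - n) (MvPowerSeries.X i : MvPowerSeries (Fin n) K) := fun a => by
  classical
  rw [MvPowerSeries.coeff_X]
  split_ifs with h
  · have hi : ((n - (i : ℕ) : ℕ) : ℤ) + ((i : ℤ) - n) = 0 := by omega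
    rw [h, wt_single, hi, hω.zero_eq, norm_one]
  · simpa using hω.nonneg _

theorem neg {d : ℤ} {Ψ : MvPowerSeries (Fin n) K} (h : WeightBounded ω d Ψ) :
    WeightBounded ω d (-Ψ) := fun a => by
  simpa using h a

variable [IsUltrametricDist K]

theorem sum (hω : IsGauge ω) {ι : Type*} {s : Finset ι} {d : ℤ}
    {Ψ : ι → MvPowerSeries (Fin n) K} (h : ∀ i ∈ s, WeightBounded ω d (Ψ i)) :
    WeightBounded ω d (∑ i ∈ s, Ψ i) := fun a => by
  rw [map_sum]
  exact IsUltrametricDist.norm_sum_le_of_forall_le_of_nonneg (hω.nonneg _) fun i hi => h i hi a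

theorem mul (hω : IsGauge ω) {d e : ℤ} {Ψ Θ : MvPowerSeries (Fin n) K}
    (h : WeightBounded ω d Ψ) (h' : WeightBounded ω e Θ) :
    WeightBounded ω (d + e) (Ψ * Θ) := fun a => by
  classical
  rw [MvPowerSeries.coeff_mul]
  refine IsUltrametricDist.norm_sum_le_of_forall_le_of_nonneg (hω.nonneg _) fun x hx => ?_
  rw [norm_mul, ← mem_antidiagonal.mp hx, wt_add]
  refine (mul_le_mul (h _) (h' _) (norm_nonneg _) (hω.nonneg _)).trans
    ((hω.mul_le _ _).trans_eq (congrArg ω ?_))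
  push_cast
  ring

end WeightBounded

theorem seriesBounded_one (hω : IsGauge ω) :
    SeriesBounded ω 0 (1 : PowerSeries (MvPowerSeries (Fin n) K)) := fun i => by
  rw [PowerSeries.coeff_one]
  split_ifs with hi
  · simpa [hi] using WeightBounded.one hω
  · exact WeightBounded.zero hω _

theorem seriesBounded_genericSeries (hω : IsGauge ω) {f : ℕ → K} (hf : ∀ k : ℕ, ‖f k‖ ≤ ω k) :
    SeriesBounded ω (-n) (genericSeries n f) := fun i => by
  rcases lt_or_ge i n with hi | hi
  · rw [coeff_genericSeries_of_lt f hi]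
    exact WeightBounded.X hω ⟨i, hi⟩
  · obtain ⟨k, rfl⟩ := Nat.exists_eq_add_of_le hi
    rw [coeff_add_genericSeries]
    refine WeightBounded.C hω ((hf k).trans_eq (congrArg ω ?_))
    push_cast
    ring

variable [IsUltrametricDist K]

theorem SeriesBounded.mul (hω : IsGauge ω) {d e : ℤ} {S T : PowerSeries (MvPowerSeries (Fin n) K)}
    (h : SeriesBounded ω d S) (h' : SeriesBounded ω e T) :
    SeriesBounded ω (d + e) (S * T) := fun i => by
  rw [PowerSeries.coeff_mul]
  refine WeightBounded.sum hω fun x hx => ?_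
  convert (h x.1).mul hω (h' x.2) using 1
  rw [← mem_antidiagonal.mp hx]
  push_cast
  ring

theorem SeriesBounded.of_coeff_mul_eq (hω : IsGauge ω) {m : ℕ} {d : ℤ}
    {q S T : PowerSeries (MvPowerSeries (Fin n) K)} (hS : SeriesBounded ω (-m) S)
    (hS_low : ∀ l < m, MvPowerSeries.constantCoeff (PowerSeries.coeff l S) = 0)
    (hS_unit : ‖MvPowerSeries.constantCoeff (PowerSeries.coeff m S)‖ = 1)
    (hT : SeriesBounded ω d T)
    (hq : ∀ i, PowerSeries.coeff (i + m) (q * S) = PowerSeries.coeff i T) :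
    SeriesBounded ω d q := by
  classical
  suffices ∀ (x : ℕ ×ₗ ℕ) (i : ℕ) (a : Fin n →₀ ℕ), toLex (a.degree, i) = x →
      ‖MvPowerSeries.coeff a (PowerSeries.coeff i q)‖ ≤ ω (wt a + (i + d)) from
    fun i a => this _ i a rfl
  intro x
  induction x using WellFoundedLT.induction with
  | ind x ih =>
  rintro i a rfl
  have hterm : ∀ t ∈ lowerTerms m a i, ‖MvPowerSeries.coeff t.2.1 (PowerSeries.coeff t.1.1 q) *
      MvPowerSeries.coeff t.2.2 (PowerSeries.coeff t.1.2 S)‖ ≤ ω (wt a + (i + d)) := by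
    rintro ⟨⟨j, l⟩, b, c⟩ ht
    simp only [lowerTerms, mem_filter, mem_product, HasAntidiagonal.mem_antidiagonal] at ht
    obtain ⟨⟨hjl, hbc⟩, hlt⟩ := ht
    rw [norm_mul]
    refine (mul_le_mul (ih _ hlt j b rfl) (hS l c) (norm_nonneg _) (hω.nonneg _)).trans
      ((hω.mul_le _ _).trans_eq (congrArg ω ?_))
    rw [← hbc, wt_add]
    push_cast
    linarith [(by exact_mod_cast hjl : (j : ℤ) + l = i + m)]
  have hmain : MvPowerSeries.coeff a (PowerSeries.coeff i q) *
      MvPowerSeries.constantCoeff (PowerSeries.coeff m S) =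
        MvPowerSeries.coeff a (PowerSeries.coeff i T) -
          ∑ t ∈ lowerTerms m a i, MvPowerSeries.coeff t.2.1 (PowerSeries.coeff t.1.1 q) *
            MvPowerSeries.coeff t.2.2 (PowerSeries.coeff t.1.2 S) := by
    rw [← hq, coeff_coeff_mul_eq_add_sum_lowerTerms hS_low, add_sub_cancel_right]
  rw [← mul_one ‖_‖, ← hS_unit, ← norm_mul, hmain]
  exact (norm_sub_le_max _ _).trans (max_le (hT i a)
    (IsUltrametricDist.norm_sum_le_of_forall_le_of_nonneg (hω.nonneg _) hterm))

theorem X_pow_add_natDegree_modByMonic {A : Type*} [CommRing A] {P : Polynomial A} (hP : P.Monic)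
    (l : ℕ) : Polynomial.X ^ (l + P.natDegree) %ₘ P =
      -∑ i ∈ range P.natDegree, P.coeff i • (Polynomial.X ^ (l + i) %ₘ P) := by
  have h : Polynomial.X ^ (l + P.natDegree) = Polynomial.X ^ l * P -
      ∑ i ∈ range P.natDegree, P.coeff i • Polynomial.X ^ (l + i) := by
    conv_rhs => enter [1]; rw [hP.as_sum]
    simp only [Polynomial.smul_eq_C_mul, mul_add, mul_sum, pow_add]
    rw [add_sub_assoc, ← sum_sub_distrib, sum_eq_zero fun i _ => by ring, add_zero]
  rw [h, Polynomial.sub_modByMonic, Polynomial.mul_self_modByMonic hP, zero_sub]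
  simp only [← Polynomial.modByMonicHom_apply, map_sum, map_smul]

namespace WeierstrassFactorization

variable {f : ℕ → K} (d : WeierstrassFactorization n f)

theorem seriesBounded_inv (hω : IsGauge ω) (hf0 : ‖f 0‖ = 1) (hf : ∀ k : ℕ, ‖f k‖ ≤ ω k) :
    SeriesBounded ω 0 d.inv :=
  .of_coeff_mul_eq hω (seriesBounded_genericSeries hω hf)
    (fun _ hl => constantCoeff_coeff_genericSeries_of_lt f hl)
    (by rwa [constantCoeff_coeff_genericSeries_self]) (seriesBounded_one hω)
    d.coeff_add_inv_mul_genericSeries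

theorem seriesBounded_unit (hω : IsGauge ω) (hf0 : ‖f 0‖ = 1) (hf : ∀ k : ℕ, ‖f k‖ ≤ ω k) :
    SeriesBounded ω 0 d.unit :=
  .of_coeff_mul_eq hω (m := 0) (by simpa using d.seriesBounded_inv hω hf0 hf)
    (fun _ hl => absurd hl (Nat.not_lt_zero _))
    (by simpa [hf0] using congrArg norm d.constantCoeff_coeff_zero_inv_mul)
    (seriesBounded_one hω) fun i => by rw [add_zero, d.unit_mul_inv]

theorem weightBounded_coeff_poly (hω : IsGauge ω) (hf0 : ‖f 0‖ = 1)
    (hf : ∀ k : ℕ, ‖f k‖ ≤ ω k) (i : ℕ) : WeightBounded ω (i - n) (d.poly.coeff i) := by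
  have h := (d.seriesBounded_inv hω hf0 hf).mul hω (seriesBounded_genericSeries hω hf) i
  rwa [d.inv_mul_genericSeries, Polynomial.coeff_coe, zero_add] at h

theorem weightBounded_coeff_X_pow_modByMonic (hω : IsGauge ω) (hf0 : ‖f 0‖ = 1)
    (hf : ∀ k : ℕ, ‖f k‖ ≤ ω k) (k j : ℕ) :
    WeightBounded ω (j - k) ((Polynomial.X ^ k %ₘ d.poly).coeff j) := by
  induction k using Nat.strong_induction_on generalizing j with
  | _ k ih =>
  have hmonic := d.isMonicOfDegree.monic
  rcases lt_or_ge k n with hk | hk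
  · rw [(Polynomial.modByMonic_eq_self_iff hmonic).mpr, Polynomial.coeff_X_pow]
    · split_ifs with hj
      · simpa [hj] using WeightBounded.one hω
      · exact WeightBounded.zero hω _
    · rw [Polynomial.degree_eq_natDegree hmonic.ne_zero, d.isMonicOfDegree.natDegree_eq]
      exact (Polynomial.degree_X_pow_le k).trans_lt (by exact_mod_cast hk)
  · obtain ⟨l, rfl⟩ := Nat.exists_eq_add_of_le' hk
    have hmod := X_pow_add_natDegree_modByMonic hmonic l
    rw [d.isMonicOfDegree.natDegree_eq] at hmod
    rw [hmod, Polynomial.coeff_neg, Polynomial.finsetSum_coeff]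
    refine (WeightBounded.sum hω fun i hi => ?_).neg
    rw [Polynomial.coeff_smul, smul_eq_mul]
    convert (d.weightBounded_coeff_poly hω hf0 hf i).mul hω
      (ih (l + i) (by have := mem_range.mp hi; omega) j) using 1
    push_cast
    ring

end WeierstrassFactorization

end Weights

section ResultantSeries

namespace WeierstrassFactorization

variable {n : ℕ} {A : Type*} [CommRing A] {f : ℕ → A} (d : WeierstrassFactorization n f)

/-- The coefficient of index `j` of the remainder of `∑ k, g k * X ^ k` modulo `d.poly`. The sum
over `k` is cut off, coefficient by coefficient, where its terms vanish. -/
def remainderCoeff (g : ℕ → A) (j : ℕ) : MvPowerSeries (Fin n) A :=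
  fun a => ∑ k ∈ range (wt a + n),
    g k * MvPowerSeries.coeff a ((Polynomial.X ^ k %ₘ d.poly).coeff j)

theorem coeff_remainderCoeff (g : ℕ → A) (j : ℕ) (a : Fin n →₀ ℕ) :
    MvPowerSeries.coeff a (d.remainderCoeff g j) = ∑ k ∈ range (wt a + n),
      g k * MvPowerSeries.coeff a ((Polynomial.X ^ k %ₘ d.poly).coeff j) := rfl

/-- The remainder of the series `∑ k, g k * X ^ k` modulo `d.poly`. -/
def remainder (g : ℕ → A) : Polynomial (MvPowerSeries (Fin n) A) :=
  ∑ j ∈ range n, Polynomial.monomial j (d.remainderCoeff g j)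

theorem coeff_remainder (g : ℕ → A) (j : ℕ) :
    (d.remainder g).coeff j = if j < n then d.remainderCoeff g j else 0 := by
  simp [remainder, Polynomial.finsetSum_coeff, Polynomial.coeff_monomial]

/-- The resultant of `genericSeries n f` and `∑ k, g k * X ^ k`, where `N` stands for the degree of
the latter: up to the factor `f 0 ^ N`, it is the resultant of `d.poly` and of the remainder. -/
def resultantSeries (g : ℕ → A) (N : ℕ) : MvPowerSeries (Fin n) A :=
  MvPowerSeries.C (f 0 ^ N) * d.poly.resultant (d.remainder g) n n

variable {B : Type*} [CommRing B] [Nontrivial B] (φ : A →+* B)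

theorem remainder_map (g : ℕ → A) :
    (d.map φ).remainder (fun k => φ (g k)) = (d.remainder g).map (MvPowerSeries.map φ) := by
  ext j a
  have h (k : ℕ) : Polynomial.X ^ k %ₘ (d.map φ).poly =
      (Polynomial.X ^ k %ₘ d.poly).map (MvPowerSeries.map φ) := by
    rw [Polynomial.map_modByMonic _ d.isMonicOfDegree.monic, Polynomial.map_pow, Polynomial.map_X]
    rfl
  rw [Polynomial.coeff_map, coeff_remainder, coeff_remainder]
  split_ifs
  · simp only [MvPowerSeries.coeff_map, coeff_remainderCoeff, h, Polynomial.coeff_map, map_sum,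
      map_mul]
  · rw [map_zero, map_zero, map_zero]

theorem resultantSeries_map (g : ℕ → A) (N : ℕ) :
    (d.map φ).resultantSeries (fun k => φ (g k)) N =
      MvPowerSeries.map φ (d.resultantSeries g N) := by
  rw [resultantSeries, resultantSeries, remainder_map, map_mul, MvPowerSeries.map_C, ← map_pow φ,
    ← Polynomial.resultant_map_map]
  rfl

end WeierstrassFactorization

end ResultantSeries

section Value

theorem summable_prod_of_norm_le {K κ ι : Type*} [NormedField K] [IsUltrametricDist K]
    [CompleteSpace K] {t : κ × ι → K} {b : ι → ℝ} (hb : Tendsto b cofinite (𝓝 0))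
    (ht : ∀ k a, ‖t (k, a)‖ ≤ b a) (hfin : ∀ a, {k | t (k, a) ≠ 0}.Finite) : Summable t := by
  refine NonarchimedeanAddGroup.summable_of_tendsto_cofinite_zero ?_
  rw [NormedAddGroup.tendsto_nhds_zero]
  intro ε hε
  have hsmall := hb.eventually (gt_mem_nhds hε)
  rw [eventually_cofinite] at hsmall ⊢
  refine (hsmall.biUnion fun a _ => (hfin a).prod (Set.finite_singleton a)).subset ?_
  rintro ⟨k, a⟩ hka
  simp only [Set.mem_ofPred_eq, not_lt] at hka
  simp only [Set.mem_iUnion, Set.mem_prod, Set.mem_ofPred_eq, Set.mem_singleton_iff, not_lt]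
  exact ⟨a, hka.trans (ht k a), norm_pos_iff.mp (hε.trans_le hka), rfl⟩

theorem eval_eq_sum_range_of_degree_lt {A : Type*} [Semiring A] {P : Polynomial A} {n : ℕ}
    (h : P.degree < n) (z : A) : P.eval z = ∑ i ∈ range n, P.coeff i * z ^ i := by
  rcases eq_or_ne P 0 with rfl | hP
  · simp
  · exact Polynomial.eval_eq_sum_range' ((Polynomial.natDegree_lt_iff_degree_lt hP).mpr h) z

variable {K : Type*} [NormedField K] {n : ℕ} {ω : ℤ → ℝ} {x : Fin n → K}

/-- At the point `x` the monomials compensate the growth allowed by the gauge. -/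
structure IsTame (ω : ℤ → ℝ) (x : Fin n → K) : Prop where
  norm_le_one : ∀ i, ‖x i‖ ≤ 1
  tendsto : ∀ e : ℤ, Tendsto (fun a : Fin n →₀ ℕ => ω (wt a + e) * ‖monomialValue x a‖)
    cofinite (𝓝 0)

theorem IsTame.norm_monomialValue_le_one (hx : IsTame ω x) (a : Fin n →₀ ℕ) :
    ‖monomialValue x a‖ ≤ 1 := by
  simpa using norm_monomialValue_le_pow hx.norm_le_one a

variable [IsUltrametricDist K]

theorem SeriesBounded.norm_mvEval_coeff_le (hω : IsGauge ω) (hx : IsTame ω x)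
    {S : PowerSeries (MvPowerSeries (Fin n) K)} (hS : SeriesBounded ω 0 S) (k : ℕ) :
    ‖mvEval x (PowerSeries.coeff k S)‖ ≤ ω k := by
  refine norm_mvEval_le (hω.nonneg _) fun a => ?_
  calc _ ≤ ‖MvPowerSeries.coeff a (PowerSeries.coeff k S)‖ :=
        mul_le_of_le_one_right (norm_nonneg _) (hx.norm_monomialValue_le_one a)
    _ ≤ ω (wt a + (k + 0)) := hS k a
    _ ≤ ω k := hω.anti _ _ (by omega) (by omega)

theorem IsTame.convergesAt [CompleteSpace K] (hx : IsTame ω x) {e : ℤ} {Ψ : MvPowerSeries (Fin n) K}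
    (h : WeightBounded ω e Ψ) : ConvergesAt x Ψ :=
  NonarchimedeanAddGroup.summable_of_tendsto_cofinite_zero <|
    squeeze_zero_norm (fun a => by rw [norm_mul]; gcongr; exact h a) (hx.tendsto e)

namespace WeierstrassFactorization

variable {f : ℕ → K} (d : WeierstrassFactorization n f) (hω : IsGauge ω) (hf0 : ‖f 0‖ = 1)
  (hf : ∀ k : ℕ, ‖f k‖ ≤ ω k)

include hω hf0 hf

theorem norm_coeff_mvEvalPoly_le {r : ℝ} (hr1 : r ≤ 1) (hr : ∀ i, ‖x i‖ ≤ r) {i : ℕ}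
    (hi : i < n) : ‖(mvEvalPoly x d.poly).coeff i‖ ≤ r := by
  have hr0 : 0 ≤ r := (norm_nonneg _).trans (hr ⟨i, hi⟩)
  rw [coeff_mvEvalPoly]
  refine norm_mvEval_le hr0 fun a => ?_
  have h := d.weightBounded_coeff_poly hω hf0 hf i a
  rcases eq_or_ne a 0 with rfl | ha
  · rw [hω.eq_zero _ (by rw [wt_zero]; omega)] at h
    rwa [le_antisymm h (norm_nonneg _), zero_mul]
  · refine (mul_le_of_le_one_left (norm_nonneg _) (h.trans (hω.le_one _))).trans
      ((norm_monomialValue_le_pow hr a).trans (pow_le_of_le_one hr0 hr1 ?_))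
    rwa [ne_eq, Finsupp.degree_eq_zero_iff]

theorem coeff_coeff_X_pow_modByMonic_eq_zero {j k : ℕ} {a : Fin n →₀ ℕ} (h : wt a + j < k) :
    MvPowerSeries.coeff a ((Polynomial.X ^ k %ₘ d.poly).coeff j) = 0 := by
  have hle := d.weightBounded_coeff_X_pow_modByMonic hω hf0 hf k j a
  rw [hω.eq_zero _ (by omega)] at hle
  exact norm_le_zero_iff.mp hle

variable [CompleteSpace K] (hx : IsTame ω x)

include hx

theorem mvEvalPoly_mul_mvEvalSeries_unit :
    (mvEvalPoly x d.poly : PowerSeries K) * mvEvalSeries x d.unit =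
      mvEvalSeries x (genericSeries n f) := by
  rw [← mvEvalSeries_coe, ← d.poly_mul_unit, mvEvalSeries_mul]
  · intro i
    rw [Polynomial.coeff_coe]
    exact hx.convergesAt (d.weightBounded_coeff_poly hω hf0 hf i)
  · exact fun i => hx.convergesAt (d.seriesBounded_unit hω hf0 hf i)

theorem norm_mvEval_coeff_zero_unit : ‖mvEval x (PowerSeries.coeff 0 d.unit)‖ = 1 := by
  have hmul := (hasSum_mvEval_mul (hx.convergesAt (d.seriesBounded_unit hω hf0 hf 0))
    (hx.convergesAt (d.seriesBounded_inv hω hf0 hf 0))).tsum_eq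
  have hone : PowerSeries.coeff 0 d.unit * PowerSeries.coeff 0 d.inv = 1 := by
    simpa using congrArg (PowerSeries.coeff 0) d.unit_mul_inv
  rw [hone, ← map_one MvPowerSeries.C, (hasSum_mvEval_C x 1).tsum_eq] at hmul
  have hnorm : 1 = ‖mvEval x (PowerSeries.coeff 0 d.unit)‖ *
      ‖mvEval x (PowerSeries.coeff 0 d.inv)‖ := by
    rw [← norm_mul, ← hmul, norm_one]
  refine le_antisymm (((d.seriesBounded_unit hω hf0 hf).norm_mvEval_coeff_le hω hx 0).trans
    (hω.le_one _)) ?_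
  rw [hnorm]
  exact mul_le_of_le_one_right (norm_nonneg _)
    (((d.seriesBounded_inv hω hf0 hf).norm_mvEval_coeff_le hω hx 0).trans (hω.le_one _))

variable {g : ℕ → K} {c : ℝ} (hg : ∀ k : ℕ, ‖g k‖ ≤ c * ω k)

include hg

theorem summable_mul_coeff_X_pow_modByMonic (j : ℕ) :
    Summable fun y : ℕ × (Fin n →₀ ℕ) => g y.1 *
      (MvPowerSeries.coeff y.2 ((Polynomial.X ^ y.1 %ₘ d.poly).coeff j) *
        monomialValue x y.2) := by
  have hc : 0 ≤ c := by simpa [hω.zero_eq] using (norm_nonneg _).trans (hg 0)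
  refine summable_prod_of_norm_le (b := fun a => c * (ω (wt a + j) * ‖monomialValue x a‖))
    (by simpa using (hx.tendsto j).const_mul c) (fun k a => ?_) fun a => ?_
  · have hR := d.weightBounded_coeff_X_pow_modByMonic hω hf0 hf k j a
    calc _ = ‖g k‖ * ‖MvPowerSeries.coeff a ((Polynomial.X ^ k %ₘ d.poly).coeff j)‖ *
          ‖monomialValue x a‖ := by rw [norm_mul, norm_mul, mul_assoc]
      _ ≤ c * ω k * ω (wt a + (j - k)) * ‖monomialValue x a‖ := by
        have := hω.nonneg k
        gcongr
        exact hg k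
      _ = c * (ω k * ω (wt a + (j - k)) * ‖monomialValue x a‖) := by ring
      _ ≤ c * (ω (k + (wt a + (j - k))) * ‖monomialValue x a‖) := by
        gcongr
        exact hω.mul_le _ _
      _ = c * (ω (wt a + j) * ‖monomialValue x a‖) := by ring_nf
  · refine (Set.finite_le_nat (wt a + j)).subset fun k hk => ?_
    by_contra h
    rw [Set.mem_ofPred_eq, not_le] at h
    refine hk ?_
    simp only [d.coeff_coeff_X_pow_modByMonic_eq_zero hω hf0 hf h, zero_mul, mul_zero]

theorem convergesAt_remainderCoeff_and_hasSum {j : ℕ} (hj : j < n) :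
    ConvergesAt x (d.remainderCoeff g j) ∧
      HasSum (fun k => g k * mvEval x ((Polynomial.X ^ k %ₘ d.poly).coeff j))
        (mvEval x (d.remainderCoeff g j)) := by
  have hs := (d.summable_mul_coeff_X_pow_modByMonic hω hf0 hf hx hg j).hasSum
  have hk := hs.prod_fiberwise fun k =>
    (hx.convergesAt (d.weightBounded_coeff_X_pow_modByMonic hω hf0 hf k j)).hasSum.mul_left (g k)
  have ha : HasSum (fun a => MvPowerSeries.coeff a (d.remainderCoeff g j) * monomialValue x a)
      (∑' y : ℕ × (Fin n →₀ ℕ), g y.1 *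
        (MvPowerSeries.coeff y.2 ((Polynomial.X ^ y.1 %ₘ d.poly).coeff j) *
          monomialValue x y.2)) := by
    refine HasSum.prod_fiberwise ((Equiv.hasSum_iff (Equiv.prodComm _ _)).mpr hs) fun a => ?_
    rw [coeff_remainderCoeff, sum_mul, sum_congr rfl fun k _ => mul_assoc (g k) _ _]
    refine hasSum_sum_of_ne_finset_zero fun k hk => ?_
    rw [mem_range, not_lt] at hk
    simp only [Function.comp_apply, Equiv.prodComm_apply, Prod.swap_prod_mk,
      d.coeff_coeff_X_pow_modByMonic_eq_zero hω hf0 hf (show wt a + j < k by omega), zero_mul,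
      mul_zero]
  refine ⟨ha.summable, ?_⟩
  rwa [mvEval, ha.tsum_eq]

omit hg in
theorem sum_mvEval_coeff_X_pow_modByMonic_mul_pow {z : K} (hz : (mvEvalPoly x d.poly).IsRoot z)
    (k : ℕ) :
    ∑ j ∈ range n, mvEval x ((Polynomial.X ^ k %ₘ d.poly).coeff j) * z ^ j = z ^ k := by
  have hmonic := isMonicOfDegree_mvEvalPoly x d.isMonicOfDegree
  have hmod : mvEvalPoly x (Polynomial.X ^ k %ₘ d.poly) =
      Polynomial.X ^ k %ₘ mvEvalPoly x d.poly := by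
    rw [mvEvalPoly_modByMonic d.isMonicOfDegree.monic _
      fun i => hx.convergesAt (d.weightBounded_coeff_poly hω hf0 hf i), mvEvalPoly_X_pow]
    intro i
    rw [Polynomial.coeff_X_pow]
    split_ifs
    exacts [(convergentSubring x).one_mem, (convergentSubring x).zero_mem]
  have heval : (Polynomial.X ^ k %ₘ mvEvalPoly x d.poly).eval z = z ^ k := by
    rw [Polynomial.modByMonic_eq_sub_mul_div]
    simp [hz.eq_zero]
  rw [← heval, ← hmod]
  simp only [← coeff_mvEvalPoly]
  refine (eval_eq_sum_range_of_degree_lt ?_ z).symm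
  rw [hmod, ← (Polynomial.degree_eq_iff_natDegree_eq hmonic.ne_zero).mpr hmonic.natDegree_eq]
  exact Polynomial.degree_modByMonic_lt _ hmonic.monic

theorem hasSum_eval_mvEvalPoly_remainder {z : K} (hz : (mvEvalPoly x d.poly).IsRoot z) :
    HasSum (fun k => g k * z ^ k) ((mvEvalPoly x (d.remainder g)).eval z) := by
  have heval : (mvEvalPoly x (d.remainder g)).eval z =
      ∑ j ∈ range n, mvEval x (d.remainderCoeff g j) * z ^ j := by
    rw [eval_eq_sum_range_of_degree_lt (n := n)]
    · refine sum_congr rfl fun j hj => ?_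
      rw [coeff_mvEvalPoly, coeff_remainder, if_pos (mem_range.mp hj)]
    · refine (Polynomial.degree_lt_iff_coeff_zero _ _).mpr fun j hj => ?_
      rw [coeff_mvEvalPoly, coeff_remainder, if_neg hj.not_gt, mvEval_zero]
  have hsum := hasSum_sum fun j hj => ((d.convergesAt_remainderCoeff_and_hasSum hω hf0 hf hx hg
    (mem_range.mp hj)).2.mul_right (z ^ j))
  simp only [mul_assoc, ← mul_sum,
    d.sum_mvEval_coeff_X_pow_modByMonic_mul_pow hω hf0 hf hx hz] at hsum
  rwa [heval]

theorem hasSum_resultantSeries [IsAlgClosed K] (N : ℕ) :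
    HasSum (fun a => MvPowerSeries.coeff a (d.resultantSeries g N) * monomialValue x a)
      (f 0 ^ N * ((mvEvalPoly x d.poly).roots.map fun z => ∑' k, g k * z ^ k).prod) := by
  have hmonic := isMonicOfDegree_mvEvalPoly x d.isMonicOfDegree
  have hrem : (mvEvalPoly x (d.remainder g)).natDegree ≤ (mvEvalPoly x d.poly).natDegree := by
    rw [hmonic.natDegree_eq, Polynomial.natDegree_le_iff_coeff_eq_zero]
    intro j hj
    rw [coeff_mvEvalPoly, coeff_remainder, if_neg hj.le.not_gt, mvEval_zero]
  have hres := hasSum_mvEval_resultant n n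
    (fun i => hx.convergesAt (d.weightBounded_coeff_poly hω hf0 hf i))
    (Q := d.remainder g) fun j => by
      rw [coeff_remainder]
      split_ifs with hj
      exacts [(d.convergesAt_remainderCoeff_and_hasSum hω hf0 hf hx hg hj).1,
        (convergentSubring x).zero_mem]
  have hprod : ((mvEvalPoly x d.poly).roots.map fun z => ∑' k, g k * z ^ k).prod =
      (mvEvalPoly x d.poly).resultant (mvEvalPoly x (d.remainder g)) n n := by
    have h := Polynomial.resultant_eq_prod_eval (mvEvalPoly x d.poly) _ _ hrem
      (IsAlgClosed.splits _)
    rw [hmonic.monic.leadingCoeff, one_pow, one_mul, hmonic.natDegree_eq] at h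
    rw [h]
    refine congrArg Multiset.prod (Multiset.map_congr rfl fun z hz => ?_)
    exact (d.hasSum_eval_mvEvalPoly_remainder hω hf0 hf hx hg
      (Polynomial.isRoot_of_mem_roots hz)).tsum_eq
  rw [resultantSeries, hprod]
  simp only [MvPowerSeries.coeff_C_mul, mul_assoc]
  exact hres.mul_left (f 0 ^ N)

end WeierstrassFactorization

end Value

section Gauges

theorem tendsto_degree_cofinite (σ : Type*) [Finite σ] :
    Tendsto (fun a : σ →₀ ℕ => a.degree) cofinite atTop := by
  refine tendsto_atTop.mpr fun D => eventually_cofinite.mpr ?_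
  exact (Finsupp.finite_of_degree_le D).subset fun a ha => (not_le.mp ha).le

theorem tendsto_wt_cofinite (n : ℕ) : Tendsto (wt (n := n)) cofinite atTop :=
  tendsto_atTop_mono degree_le_wt (tendsto_degree_cofinite (Fin n))

variable {K : Type*} [NormedField K] {n : ℕ} {x : Fin n → K} {ω : ℤ → ℝ}

theorem IsGauge.isTame_of_norm_lt_one (hω : IsGauge ω) (hx : ∀ i, ‖x i‖ < 1) : IsTame ω x where
  norm_le_one i := (hx i).le
  tendsto e := by
    obtain ⟨r, hr0, hr1, hr⟩ : ∃ r, 0 ≤ r ∧ r < 1 ∧ ∀ i, ‖x i‖ ≤ r := by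
      have h := (pi_norm_lt_iff one_pos).mpr hx
      exact ⟨‖x‖, norm_nonneg x, h, norm_le_pi_norm x⟩
    refine squeeze_zero (fun a => mul_nonneg (hω.nonneg _) (norm_nonneg _)) (fun a => ?_)
      ((tendsto_pow_atTop_nhds_zero_of_lt_one hr0 hr1).comp (tendsto_degree_cofinite (Fin n)))
    exact (mul_le_of_le_one_left (norm_nonneg _) (hω.le_one _)).trans
      (norm_monomialValue_le_pow hr a)

theorem IsGauge.isTame_of_tendsto (hω : IsGauge ω) (h0 : Tendsto ω atTop (𝓝 0))
    (hx : ∀ i, ‖x i‖ ≤ 1) : IsTame ω x where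
  norm_le_one := hx
  tendsto e := by
    have hwt : Tendsto (fun a : Fin n →₀ ℕ => (wt a : ℤ) + e) cofinite atTop :=
      tendsto_atTop_add_const_right _ e (tendsto_natCast_atTop_atTop.comp (tendsto_wt_cofinite n))
    refine squeeze_zero (fun a => mul_nonneg (hω.nonneg _) (norm_nonneg _)) (fun a => ?_)
      (h0.comp hwt)
    exact mul_le_of_le_one_right (hω.nonneg _)
      ((norm_monomialValue_le_pow hx a).trans_eq (one_pow _))

/-- The gauge `w ↦ max ε (ρ ^ w)`. For `ε = ρ = 1` it merely bounds coefficients by `1`. -/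
def powerGauge (ε ρ : ℝ) (w : ℤ) : ℝ := if w < 0 then 0 else max ε (ρ ^ w.toNat)

variable {ε ρ : ℝ}

theorem powerGauge_of_nonneg {w : ℤ} (hw : 0 ≤ w) :
    powerGauge ε ρ w = max ε (ρ ^ w.toNat) := if_neg hw.not_gt

theorem powerGauge_natCast (k : ℕ) : powerGauge ε ρ k = max ε (ρ ^ k) := by
  rw [powerGauge_of_nonneg k.cast_nonneg, Int.toNat_natCast]

theorem isGauge_powerGauge (hε0 : 0 ≤ ε) (hε1 : ε ≤ 1) (hρ0 : 0 ≤ ρ) (hρ1 : ρ ≤ 1) :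
    IsGauge (powerGauge ε ρ) where
  eq_zero w hw := if_pos hw
  zero_eq := by simpa [powerGauge] using hε1
  nonneg w := by
    rw [powerGauge]
    split_ifs
    exacts [le_rfl, hε0.trans (le_max_left _ _)]
  anti v w hv hvw := by
    rw [powerGauge_of_nonneg hv, powerGauge_of_nonneg (hv.trans hvw)]
    exact max_le_max le_rfl (pow_le_pow_of_le_one hρ0 hρ1 (Int.toNat_le_toNat hvw))
  mul_le_of_nonneg v w hv hw := by
    have hle (k : ℕ) : max ε (ρ ^ k) ≤ 1 := max_le hε1 (pow_le_one₀ hρ0 hρ1)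
    rw [powerGauge_of_nonneg hv, powerGauge_of_nonneg hw, powerGauge_of_nonneg (add_nonneg hv hw),
      Int.toNat_add hv hw, max_mul_of_nonneg _ _ (hε0.trans (le_max_left _ _)),
      mul_max_of_nonneg _ _ (pow_nonneg hρ0 _), pow_add]
    exact max_le (le_max_of_le_left (mul_le_of_le_one_right hε0 (hle _)))
      (max_le_max (mul_le_of_le_one_left hε0 (pow_le_one₀ hρ0 hρ1)) le_rfl)

theorem bddBelow_range_gauge {ι : Type*} {ω : ι → ℤ → ℝ} (h : ∀ i, IsGauge (ω i)) (w : ℤ) :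
    BddBelow (Set.range fun i => ω i w) :=
  ⟨0, by rintro _ ⟨i, rfl⟩; exact (h i).nonneg w⟩

theorem IsGauge.iInf {ι : Type*} [Nonempty ι] {ω : ι → ℤ → ℝ} (h : ∀ i, IsGauge (ω i)) :
    IsGauge fun w => ⨅ i, ω i w where
  eq_zero w hw := by simp only [fun i => (h i).eq_zero w hw, ciInf_const]
  zero_eq := by simp only [fun i => (h i).zero_eq, ciInf_const]
  nonneg w := Real.iInf_nonneg fun i => (h i).nonneg w
  anti v w hv hvw := ciInf_mono (bddBelow_range_gauge h w) fun i => (h i).anti v w hv hvw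
  mul_le_of_nonneg v w _ _ := le_ciInf fun i =>
    (mul_le_mul (ciInf_le (bddBelow_range_gauge h v) i) (ciInf_le (bddBelow_range_gauge h w) i)
      (Real.iInf_nonneg fun j => (h j).nonneg w) ((h i).nonneg v)).trans ((h i).mul_le v w)

variable {θ : ℕ → ℝ}

theorem exists_le_powerGauge (h0 : θ 0 ≤ 1) (h1 : ∀ k > 0, θ k < 1) (hθ : Tendsto θ atTop (𝓝 0))
    (hε : 0 < ε) : ∃ ρ, 0 ≤ ρ ∧ ρ < 1 ∧ ∀ k : ℕ, θ k ≤ powerGauge ε ρ k := by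
  have hfin : {k | ¬ θ k < ε}.Finite := by
    rw [← eventually_cofinite, Nat.cofinite_eq_atTop]
    exact hθ.eventually (gt_mem_nhds hε)
  have hpow (k : ℕ) : ∀ᶠ ρ : ℝ in 𝓝[<] 1, θ k ≤ ρ ^ k := by
    rcases Nat.eq_zero_or_pos k with rfl | hk
    · simpa using h0
    · have ht : Tendsto (fun ρ : ℝ => ρ ^ k) (𝓝[<] 1) (𝓝 1) := by
        simpa using ((continuous_pow k).tendsto (1 : ℝ)).mono_left nhdsWithin_le_nhds
      exact (ht.eventually (lt_mem_nhds (h1 k hk))).mono fun _ => le_of_lt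
  obtain ⟨ρ, hρ, hρ0, hρ1⟩ := ((hfin.eventually_all.mpr fun k _ => hpow k).and
    (((lt_mem_nhds one_pos).filter_mono nhdsWithin_le_nhds).and self_mem_nhdsWithin)).exists
  refine ⟨ρ, hρ0.le, hρ1, fun k => ?_⟩
  rw [powerGauge_natCast]
  rcases lt_or_ge (θ k) ε with hk | hk
  · exact le_max_of_le_left hk.le
  · exact le_max_of_le_right (hρ k hk.not_gt)

theorem exists_isGauge_ge (h0 : θ 0 ≤ 1) (h1 : ∀ k > 0, θ k < 1) (hθ : Tendsto θ atTop (𝓝 0)) :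
    ∃ ω, IsGauge ω ∧ (∀ k : ℕ, θ k ≤ ω k) ∧ (∀ w > 0, ω w < 1) ∧ Tendsto ω atTop (𝓝 0) := by
  have hex (ε : Set.Ioc (0 : ℝ) 1) := exists_le_powerGauge h0 h1 hθ ε.2.1
  choose ρ hρ0 hρ1 hθρ using hex
  have hgauge (ε : Set.Ioc (0 : ℝ) 1) : IsGauge (powerGauge ε (ρ ε)) :=
    isGauge_powerGauge ε.2.1.le ε.2.2 (hρ0 ε) (hρ1 ε).le
  have hle (ε : Set.Ioc (0 : ℝ) 1) (w : ℤ) :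
      ⨅ ε : Set.Ioc (0 : ℝ) 1, powerGauge ε (ρ ε) w ≤ powerGauge ε (ρ ε) w :=
    ciInf_le (bddBelow_range_gauge hgauge w) ε
  have : Nonempty (Set.Ioc (0 : ℝ) 1) := ⟨⟨1, one_pos, le_rfl⟩⟩
  have hω := IsGauge.iInf hgauge
  refine ⟨_, hω, fun k => le_ciInf fun ε => hθρ ε k, fun w hw => ?_, ?_⟩
  · refine (hle ⟨1 / 2, by norm_num, by norm_num⟩ w).trans_lt ?_
    rw [powerGauge_of_nonneg hw.le]
    exact max_lt (by norm_num) (pow_lt_one₀ (hρ0 _) (hρ1 _) (by omega))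
  · refine tendsto_order.mpr ⟨fun a ha => .of_forall fun w => ha.trans_le (hω.nonneg w),
      fun a ha => ?_⟩
    let ε : Set.Ioc (0 : ℝ) 1 := ⟨min (a / 2) 1, by positivity, min_le_right _ _⟩
    have hpow : Tendsto (fun w : ℤ => ρ ε ^ w.toNat) atTop (𝓝 0) :=
      (tendsto_pow_atTop_nhds_zero_of_lt_one (hρ0 ε) (hρ1 ε)).comp
        (tendsto_atTop.mpr fun b => (eventually_ge_atTop (b : ℤ)).mono fun w hw => by omega)
    filter_upwards [hpow.eventually (gt_mem_nhds ha), eventually_ge_atTop (0 : ℤ)] with w hw hw0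
    refine (hle ε w).trans_lt ?_
    rw [powerGauge_of_nonneg hw0]
    exact max_lt ((min_le_left _ _).trans_lt (half_lt_self ha)) hw

end Gauges

section Ultrametric

variable {K : Type*} [NormedField K] [IsUltrametricDist K]

theorem norm_tsum_lt_of_forall_lt {ι : Type*} {f : ι → K} (hf : Summable f) {c : ℝ} (hc : 0 < c)
    (h : ∀ i, ‖f i‖ < c) : ‖∑' i, f i‖ < c := by
  have hnear : ∀ᶠ s in atTop, ‖∑ i ∈ s, f i - ∑' i, f i‖ < c := by
    simpa [dist_eq_norm] using Metric.tendsto_nhds.mp hf.hasSum c hc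
  obtain ⟨s, hs⟩ := hnear.exists
  have hsum : ‖∑ i ∈ s, f i‖ < c := by
    rcases s.eq_empty_or_nonempty with rfl | hne
    · simpa using hc
    · obtain ⟨i, -, hi⟩ := IsUltrametricDist.exists_norm_finsetSum_le_of_nonempty hne f
      exact hi.trans_lt (h i)
  simpa using (norm_sub_le_max (∑ i ∈ s, f i) (∑ i ∈ s, f i - ∑' i, f i)).trans_lt
    (max_lt hsum hs)

theorem exists_norm_le_norm_coeff_of_isRoot {P : Polynomial K} (hP : P.Monic) {z : K}
    (hz : P.IsRoot z) (h1 : 1 ≤ ‖z‖) : ∃ i < P.natDegree, ‖z‖ ≤ ‖P.coeff i‖ := by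
  obtain ⟨d, hd⟩ : ∃ d, P.natDegree = d + 1 := Nat.exists_eq_succ_of_ne_zero fun h0 => by
    rw [hP.natDegree_eq_zero.mp h0] at hz
    simp at hz
  have hpow : z ^ (d + 1) = -∑ i ∈ range (d + 1), P.coeff i * z ^ i := by
    have heval := hz.eq_zero
    rw [Polynomial.eval_eq_sum_range, sum_range_succ, hP.coeff_natDegree, hd, one_mul] at heval
    linear_combination heval
  obtain ⟨i, hi, hle⟩ := IsUltrametricDist.exists_norm_finsetSum_le_of_nonempty
    nonempty_range_add_one fun i => P.coeff i * z ^ i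
  have hid := mem_range.mp hi
  refine ⟨i, hd ▸ hid, le_of_mul_le_mul_right ?_ (show 0 < ‖z‖ ^ d by positivity)⟩
  calc ‖z‖ * ‖z‖ ^ d = ‖∑ i ∈ range (d + 1), P.coeff i * z ^ i‖ := by
        rw [← pow_succ', ← norm_pow, hpow, norm_neg]
    _ ≤ ‖P.coeff i‖ * ‖z‖ ^ i := by rwa [← norm_pow, ← norm_mul]
    _ ≤ ‖P.coeff i‖ * ‖z‖ ^ d := by
        gcongr
        exact Nat.lt_succ_iff.mp hid

theorem norm_resultant_le {f g : Polynomial K} (hf : ∀ i, ‖f.coeff i‖ ≤ 1)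
    (hg : ∀ i, ‖g.coeff i‖ ≤ 1) (hfg : f.natDegree ≠ 0 ∨ g.natDegree ≠ 0) {x : K}
    (hx : ‖x‖ ≤ 1) : ‖f.resultant g‖ ≤ max ‖f.eval x‖ ‖g.eval x‖ := by
  let O := (NormedField.valuation (K := K)).integer
  have hlift (q : Polynomial K) (hq : ∀ i, ‖q.coeff i‖ ≤ 1) :
      ∃ q' : Polynomial O, q'.map O.subtype = q := by
    rw [← Polynomial.mem_lifts, Polynomial.lifts_iff_coeff_lifts]
    exact fun i => ⟨⟨q.coeff i, hq i⟩, rfl⟩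
  obtain ⟨f, rfl⟩ := hlift f hf
  obtain ⟨g, rfl⟩ := hlift g hg
  have hinj : Function.Injective O.subtype := Subtype.val_injective
  rw [Polynomial.natDegree_map_eq_of_injective hinj, Polynomial.natDegree_map_eq_of_injective hinj]
    at hfg ⊢
  obtain ⟨a, b, -, -, hab⟩ := Polynomial.exists_mul_add_mul_eq_C_resultant f g le_rfl le_rfl hfg
  have heval (q : Polynomial O) : (q.map O.subtype).eval x = O.subtype (q.eval ⟨x, hx⟩) := by
    rw [Polynomial.eval_map, ← Polynomial.eval₂_at_apply]
    rfl
  have hbezout := congrArg (fun q => O.subtype (q.eval ⟨x, hx⟩)) hab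
  simp only [Polynomial.eval_add, Polynomial.eval_mul, Polynomial.eval_C, map_add, map_mul]
    at hbezout
  rw [Polynomial.resultant_map_map, ← hbezout, heval, heval]
  refine (IsUltrametricDist.norm_add_le_max _ _).trans (max_le_max ?_ ?_) <;> rw [norm_mul]
  · exact mul_le_of_le_one_right (norm_nonneg _) (a.eval _).2
  · exact mul_le_of_le_one_right (norm_nonneg _) (b.eval _).2

theorem norm_coeff_le_of_norm_coeff_mul_le {F h : PowerSeries K} {c : ℝ}
    (h0 : ‖PowerSeries.coeff 0 h‖ = 1) (hh : ∀ i, ‖PowerSeries.coeff i h‖ ≤ 1)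
    (hF : ∀ i, ‖PowerSeries.coeff i (F * h)‖ ≤ c) (i : ℕ) : ‖PowerSeries.coeff i F‖ ≤ c := by
  induction i using Nat.strong_induction_on with
  | _ i ih =>
    have hcoeff := PowerSeries.coeff_mul i F h
    rw [Nat.sum_antidiagonal_eq_sum_range_succ fun j k =>
      PowerSeries.coeff j F * PowerSeries.coeff k h, sum_range_succ, Nat.sub_self] at hcoeff
    have hsum : ‖∑ j ∈ range i, PowerSeries.coeff j F * PowerSeries.coeff (i - j) h‖ ≤ c := by
      refine IsUltrametricDist.norm_sum_le_of_forall_le_of_nonneg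
        ((norm_nonneg _).trans (hF 0)) fun j hj => ?_
      rw [norm_mul]
      exact (mul_le_of_le_one_right (norm_nonneg _) (hh _)).trans (ih j (mem_range.mp hj))
    calc ‖PowerSeries.coeff i F‖ = ‖PowerSeries.coeff i F * PowerSeries.coeff 0 h‖ := by
          rw [norm_mul, h0, mul_one]
      _ ≤ max ‖PowerSeries.coeff i (F * h)‖
          ‖∑ j ∈ range i, PowerSeries.coeff j F * PowerSeries.coeff (i - j) h‖ := by
        rw [eq_sub_of_add_eq' hcoeff.symm]
        exact norm_sub_le_max _ _
      _ ≤ c := max_le (hF i) hsum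

end Ultrametric

theorem exists_last_max {a : ℕ → ℝ} (ha : Tendsto a atTop (𝓝 0)) {j : ℕ} (hj : 0 < a j) :
    ∃ m, 0 < a m ∧ (∀ i, a i ≤ a m) ∧ ∀ i > m, a i < a m := by
  have hfin : {i | ¬ a i < a j}.Finite := by
    rw [← eventually_cofinite, Nat.cofinite_eq_atTop]
    exact ha.eventually (gt_mem_nhds hj)
  obtain ⟨m, hm, hmax⟩ := hfin.exists_maximalFor (fun i => toLex (a i, i)) _ ⟨j, lt_irrefl _⟩
  have hlex (i : ℕ) : a i < a m ∨ a i = a m ∧ i ≤ m := by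
    by_cases hi : a i < a j
    · exact Or.inl (hi.trans_le (not_lt.mp hm))
    · exact Prod.Lex.toLex_le_toLex.mp ((le_total _ _).elim (fun h => h) (hmax hi))
  refine ⟨m, hj.trans_le (not_lt.mp hm), fun i => (hlex i).elim le_of_lt fun h => h.1.le,
    fun i hi => (hlex i).resolve_right fun h => hi.not_ge h.2⟩

variable {p : ℕ} [Fact p.Prime]

section Valuation

theorem vp_le_vp_of_norm_le {x y : ℂ_[p]} (h : ‖y‖ ≤ ‖x‖) : vp x ≤ vp y := by
  rw [vp, vp]
  split_ifs with hx hy hy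
  · exact le_rfl
  · exact absurd (norm_le_zero_iff.mp (by simpa [hx] using h)) hy
  · exact le_top
  · rw [EReal.coe_le_coe_iff, neg_le_neg_iff]
    exact Real.logb_le_logb_of_le (by exact_mod_cast (Fact.out : p.Prime).one_lt)
      (norm_pos_iff.mpr hy) h

theorem vp_eq_vp_of_norm_eq {x y : ℂ_[p]} (h : ‖x‖ = ‖y‖) : vp x = vp y :=
  le_antisymm (vp_le_vp_of_norm_le h.ge) (vp_le_vp_of_norm_le h.le)

theorem min_vp_le_vp {x y z : ℂ_[p]} (h : ‖z‖ ≤ max ‖x‖ ‖y‖) : min (vp x) (vp y) ≤ vp z :=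
  (le_max_iff.mp h).elim (fun h => min_le_of_left_le (vp_le_vp_of_norm_le h))
    fun h => min_le_of_right_le (vp_le_vp_of_norm_le h)

end Valuation

section EvalAt

variable {D : Set ℂ_[p]} {F G h : PowerSeries ℂ_[p]}

theorem openDisc_subset_closedDisc : openDisc p ⊆ closedDisc p := fun x hx =>
  show ‖x‖ ≤ 1 from le_of_lt hx

theorem hasSum_coe (P : Polynomial ℂ_[p]) (x : ℂ_[p]) :
    HasSum (fun i => PowerSeries.coeff i (P : PowerSeries ℂ_[p]) * x ^ i) (P.eval x) := by
  rw [Polynomial.eval_eq_sum_range]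
  simp only [Polynomial.coeff_coe]
  refine hasSum_sum_of_ne_finset_zero fun i hi => ?_
  rw [Polynomial.coeff_eq_zero_of_natDegree_lt (by simpa using hi), zero_mul]

theorem ConvergesOn.coe_mul (hh : ConvergesOn D h) (P : Polynomial ℂ_[p]) :
    ConvergesOn D ((P : PowerSeries ℂ_[p]) * h) := fun x hx =>
  (hasSum_coeff_mul_mul_pow (hasSum_coe P x).summable (hh x hx)).summable

theorem evalAt_coe_mul (hh : ConvergesOn D h) (P : Polynomial ℂ_[p]) {x : ℂ_[p]} (hx : x ∈ D) :
    evalAt ((P : PowerSeries ℂ_[p]) * h) x = P.eval x * evalAt h x := by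
  rw [evalAt, (hasSum_coeff_mul_mul_pow (hasSum_coe P x).summable (hh x hx)).tsum_eq,
    (hasSum_coe P x).tsum_eq, evalAt]

theorem norm_evalAt_eq_one {x : ℂ_[p]} (hs : Summable fun i => PowerSeries.coeff i h * x ^ i)
    (h0 : ‖PowerSeries.coeff 0 h‖ = 1) (hi : ∀ i > 0, ‖PowerSeries.coeff i h * x ^ i‖ < 1) :
    ‖evalAt h x‖ = 1 := by
  have htail : ‖∑' i, PowerSeries.coeff (i + 1) h * x ^ (i + 1)‖ < 1 :=
    norm_tsum_lt_of_forall_lt (hs.comp_injective (add_left_injective 1)) one_pos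
      fun i => hi _ i.succ_pos
  have hval : evalAt h x = PowerSeries.coeff 0 h +
      ∑' i, PowerSeries.coeff (i + 1) h * x ^ (i + 1) := by
    rw [evalAt, hs.tsum_eq_zero_add, pow_zero, mul_one]
  rw [hval, IsUltrametricDist.norm_add_eq_max_of_norm_ne_norm (h0.trans_ne htail.ne'), h0,
    max_eq_left htail.le]

theorem convergesOn_openDisc {c : ℝ} (h : ∀ i, ‖PowerSeries.coeff i F‖ ≤ c) :
    ConvergesOn (openDisc p) F := fun x hx => by
  refine NonarchimedeanAddGroup.summable_of_tendsto_cofinite_zero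
    (squeeze_zero_norm (a := fun i => c * ‖x‖ ^ i) (fun i => ?_) ?_)
  · rw [norm_mul, norm_pow]
    gcongr
    exact h i
  · rw [Nat.cofinite_eq_atTop]
    simpa using (tendsto_pow_atTop_nhds_zero_of_lt_one (norm_nonneg x) hx).const_mul c

theorem convergesOn_closedDisc_iff : ConvergesOn (closedDisc p) F ↔
    Tendsto (fun i => ‖PowerSeries.coeff i F‖) atTop (𝓝 0) := by
  refine ⟨fun h => ?_, fun h x hx => ?_⟩
  · have hone := (h 1 norm_one.le).tendsto_cofinite_zero.norm
    rw [Nat.cofinite_eq_atTop] at hone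
    simpa using hone
  · rw [← Nat.cofinite_eq_atTop] at h
    refine NonarchimedeanAddGroup.summable_of_tendsto_cofinite_zero
      (squeeze_zero_norm (fun i => ?_) h)
    rw [norm_mul, norm_pow]
    exact mul_le_of_le_one_right (norm_nonneg _) (pow_le_one₀ (norm_nonneg _) hx)

theorem exists_isLwideg (hF : F ≠ 0) (h : ConvergesOn (closedDisc p) F) : ∃ m, IsLwideg F m := by
  obtain ⟨j, hj⟩ : ∃ j, PowerSeries.coeff j F ≠ 0 := by
    contrapose! hF
    exact PowerSeries.ext hF
  obtain ⟨m, hm0, hm⟩ := exists_last_max (convergesOn_closedDisc_iff.mp h) (norm_pos_iff.mpr hj)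
  exact ⟨m, norm_pos_iff.mp hm0, hm⟩

end EvalAt

section Multiplicity

variable {D : Set ℂ_[p]} {h : PowerSeries ℂ_[p]} {P : Polynomial ℂ_[p]} {z : ℂ_[p]}

theorem coe_X_sub_C_pow (z : ℂ_[p]) (k : ℕ) :
    (((Polynomial.X - Polynomial.C z) ^ k : Polynomial ℂ_[p]) : PowerSeries ℂ_[p]) =
      (PowerSeries.X - PowerSeries.C z) ^ k := by
  simp

theorem le_rootMultiplicity_of_coe_mul_eq (hz : z ∈ D) (hP : P ≠ 0) (hh : ConvergesOn D h)
    (hne : evalAt h z ≠ 0) {k : ℕ} {S : PowerSeries ℂ_[p]} (hS : ConvergesOn D S)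
    (heq : (P : PowerSeries ℂ_[p]) * h = (PowerSeries.X - PowerSeries.C z) ^ k * S) :
    k ≤ P.rootMultiplicity z := by
  obtain ⟨q, hq, hqz⟩ := Polynomial.exists_eq_pow_rootMultiplicity_mul_and_not_dvd P hP z
  by_contra! hlt
  obtain ⟨m, hm⟩ := Nat.exists_eq_add_of_lt hlt
  have hcancel : (q : PowerSeries ℂ_[p]) * h =
      (((Polynomial.X - Polynomial.C z) ^ (m + 1) : Polynomial ℂ_[p]) : PowerSeries ℂ_[p]) * S := by
    have hX : (PowerSeries.X - PowerSeries.C z : PowerSeries ℂ_[p]) ^ P.rootMultiplicity z ≠ 0 := by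
      rw [← coe_X_sub_C_pow, ne_eq, Polynomial.coe_eq_zero_iff]
      exact pow_ne_zero _ (Polynomial.X_sub_C_ne_zero z)
    refine mul_left_cancel₀ hX ?_
    rw [coe_X_sub_C_pow, ← mul_assoc, ← mul_assoc, ← pow_add, ← add_assoc, ← hm, ← heq,
      ← coe_X_sub_C_pow, ← Polynomial.coe_mul, ← hq]
  have heval := congrArg (evalAt · z) hcancel
  simp only [evalAt_coe_mul hh _ hz, evalAt_coe_mul hS _ hz] at heval
  have hqz' : q.eval z ≠ 0 := fun h0 => hqz (Polynomial.dvd_iff_isRoot.mpr h0)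
  simp [hne, hqz'] at heval

theorem zeroMult_coe_mul (hz : z ∈ D) (hP : P ≠ 0) (hh : ConvergesOn D h)
    (hne : evalAt h z ≠ 0) :
    zeroMult D ((P : PowerSeries ℂ_[p]) * h) z = P.rootMultiplicity z := by
  refine IsGreatest.csSup_eq ⟨?_, fun k ⟨S, hS, heq⟩ =>
    le_rootMultiplicity_of_coe_mul_eq hz hP hh hne hS heq⟩
  obtain ⟨q, hq, -⟩ := Polynomial.exists_eq_pow_rootMultiplicity_mul_and_not_dvd P hP z
  refine ⟨_, hh.coe_mul q, ?_⟩
  rw [← coe_X_sub_C_pow, ← mul_assoc, ← Polynomial.coe_mul, ← hq]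

end Multiplicity

section Prepared

/-- A factorisation `F = F_n P h` over the disc `D`, with `P` monic of degree `n` with integral
coefficients and roots in `D`, and with `h` of absolute value `1` on `D`. Distinguished polynomials
for either disc provide one. -/
structure IsPrepared (D : Set ℂ_[p]) (F : PowerSeries ℂ_[p]) (n : ℕ) (P : Polynomial ℂ_[p])
    (h : PowerSeries ℂ_[p]) : Prop where
  monic : P.Monic
  natDegree_eq : P.natDegree = n
  coeff_ne_zero : PowerSeries.coeff n F ≠ 0
  norm_coeff_le : ∀ i, ‖P.coeff i‖ ≤ 1
  mem_of_isRoot : ∀ z, P.IsRoot z → z ∈ D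
  convergesOn : ConvergesOn D h
  norm_evalAt : ∀ x ∈ D, ‖evalAt h x‖ = 1
  eq_mul : F = PowerSeries.C (PowerSeries.coeff n F) * (P : PowerSeries ℂ_[p]) * h

namespace IsPrepared

variable {D : Set ℂ_[p]} {F G : PowerSeries ℂ_[p]} {n N : ℕ} {P Q : Polynomial ℂ_[p]}
  {h k : PowerSeries ℂ_[p]}

theorem eq_coe_mul (H : IsPrepared D F n P h) :
    F = ((Polynomial.C (PowerSeries.coeff n F) * P : Polynomial ℂ_[p]) : PowerSeries ℂ_[p]) *
      h := by
  rw [Polynomial.coe_mul, Polynomial.coe_C]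
  exact H.eq_mul

theorem C_mul_ne_zero (H : IsPrepared D F n P h) :
    Polynomial.C (PowerSeries.coeff n F) * P ≠ 0 :=
  mul_ne_zero (Polynomial.C_ne_zero.mpr H.coeff_ne_zero) H.monic.ne_zero

theorem evalAt_ne_zero (H : IsPrepared D F n P h) {x : ℂ_[p]} (hx : x ∈ D) : evalAt h x ≠ 0 := by
  rw [← norm_pos_iff, H.norm_evalAt x hx]
  exact one_pos

theorem evalAt_eq (H : IsPrepared D F n P h) {x : ℂ_[p]} (hx : x ∈ D) :
    evalAt F x = (Polynomial.C (PowerSeries.coeff n F) * P).eval x * evalAt h x := by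
  conv_lhs => rw [H.eq_coe_mul, evalAt_coe_mul H.convergesOn _ hx]

theorem norm_evalAt_eq (H : IsPrepared D F n P h) {x : ℂ_[p]} (hx : x ∈ D) :
    ‖evalAt F x‖ = ‖(Polynomial.C (PowerSeries.coeff n F) * P).eval x‖ := by
  rw [H.evalAt_eq hx, norm_mul, H.norm_evalAt x hx, mul_one]

theorem mem_of_mem_roots (H : IsPrepared D F n P h) {z : ℂ_[p]} (hz : z ∈ P.roots) : z ∈ D :=
  H.mem_of_isRoot z (Polynomial.isRoot_of_mem_roots hz)

theorem mem_zeros_iff (H : IsPrepared D F n P h) {z : ℂ_[p]} : z ∈ zeros D F ↔ z ∈ P.roots := by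
  have hzero (hz : z ∈ D) : evalAt F z = 0 ↔ z ∈ P.roots := by
    rw [H.evalAt_eq hz, mul_eq_zero_iff_right (H.evalAt_ne_zero hz), Polynomial.eval_C_mul,
      mul_eq_zero_iff_left H.coeff_ne_zero, Polynomial.mem_roots H.monic.ne_zero,
      Polynomial.IsRoot.def]
  exact ⟨fun hz => (hzero hz.1).mp hz.2,
    fun hz => ⟨H.mem_of_mem_roots hz, (hzero (H.mem_of_mem_roots hz)).mpr hz⟩⟩

open scoped Classical in
theorem zeros_eq (H : IsPrepared D F n P h) : zeros D F = P.roots.toFinset := by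
  ext z
  rw [mem_coe, Multiset.mem_toFinset, H.mem_zeros_iff]

open scoped Classical in
theorem zeroMult_eq (H : IsPrepared D F n P h) {z : ℂ_[p]} (hz : z ∈ D) :
    zeroMult D F z = P.roots.count z := by
  conv_lhs => rw [H.eq_coe_mul]
  rw [zeroMult_coe_mul hz H.C_mul_ne_zero H.convergesOn (H.evalAt_ne_zero hz),
    ← Polynomial.count_roots, Polynomial.roots_C_mul _ H.coeff_ne_zero]

theorem card_roots (H : IsPrepared D F n P h) : P.roots.card = n :=
  (Polynomial.splits_iff_card_roots.mp (IsAlgClosed.splits P)).trans H.natDegree_eq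

theorem finprod_zeros (H : IsPrepared D F n P h) (φ : ℂ_[p] → ℂ_[p]) :
    ∏ᶠ z ∈ zeros D F, φ z ^ zeroMult D F z = (P.roots.map φ).prod := by
  classical
  rw [Finset.prod_multiset_map_count, H.zeros_eq, finprod_mem_coe_finset]
  refine prod_congr rfl fun z hz => ?_
  rw [H.zeroMult_eq (H.mem_of_mem_roots (Multiset.mem_toFinset.mp hz))]

theorem finsum_zeroMult (H : IsPrepared D F n P h) : ∑ᶠ z ∈ zeros D F, zeroMult D F z = n := by
  classical
  rw [H.zeros_eq, finsum_mem_coe_finset]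
  refine Eq.trans (sum_congr rfl fun z hz => ?_)
    ((Multiset.toFinset_sum_count_eq P.roots).trans H.card_roots)
  exact H.zeroMult_eq (H.mem_of_mem_roots (Multiset.mem_toFinset.mp hz))

theorem resultantExists (H : IsPrepared D F n P h) (hG : ConvergesOn D G) :
    ResultantExists D n F G := by
  classical
  refine ⟨?_, fun z hz => ?_, H.finsum_zeroMult, fun z hz => hG z hz.1⟩
  · rw [H.zeros_eq]
    exact finite_toSet _
  · rw [H.zeroMult_eq hz.1]
    exact Multiset.one_le_count_iff_mem.mpr (H.mem_zeros_iff.mp hz)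

theorem discResultant_eq (H : IsPrepared D F n P h) (N : ℕ) (G : PowerSeries ℂ_[p]) :
    discResultant D n N F G =
      PowerSeries.coeff n F ^ N * (P.roots.map fun z => evalAt G z).prod := by
  rw [discResultant, H.finprod_zeros]

theorem natDegree_C_mul (H : IsPrepared D F n P h) :
    (Polynomial.C (PowerSeries.coeff n F) * P).natDegree = n := by
  rw [Polynomial.natDegree_C_mul H.coeff_ne_zero, H.natDegree_eq]

theorem norm_coeff_C_mul_le (H : IsPrepared D F n P h) (hF : HasIntegralCoeffs F) (i : ℕ) :
    ‖(Polynomial.C (PowerSeries.coeff n F) * P).coeff i‖ ≤ 1 := by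
  rw [Polynomial.coeff_C_mul, norm_mul]
  exact mul_le_one₀ (hF n) (norm_nonneg _) (H.norm_coeff_le i)

theorem resultant_eq_prod_eval (H : IsPrepared D F n P h) (H' : IsPrepared D G N Q k) :
    (Polynomial.C (PowerSeries.coeff n F) * P).resultant
      (Polynomial.C (PowerSeries.coeff N G) * Q) =
    PowerSeries.coeff n F ^ N *
      (P.roots.map fun z => (Polynomial.C (PowerSeries.coeff N G) * Q).eval z).prod := by
  rw [Polynomial.resultant_eq_prod_eval _ _ _ le_rfl (IsAlgClosed.splits _), H'.natDegree_C_mul,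
    Polynomial.leadingCoeff_C_mul_of_isUnit H.coeff_ne_zero.isUnit, H.monic.leadingCoeff, mul_one,
    Polynomial.roots_C_mul _ H.coeff_ne_zero]

theorem norm_discResultant (H : IsPrepared D F n P h) (H' : IsPrepared D G N Q k) :
    ‖discResultant D n N F G‖ = ‖(Polynomial.C (PowerSeries.coeff n F) * P).resultant
      (Polynomial.C (PowerSeries.coeff N G) * Q)‖ := by
  have hnorm (φ : ℂ_[p] → ℂ_[p]) :
      ‖(P.roots.map φ).prod‖ = (P.roots.map fun z => ‖φ z‖).prod := by
    simpa [Multiset.map_map] using map_multiset_prod (normHom (α := ℂ_[p])) (P.roots.map φ)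
  rw [H.discResultant_eq, H.resultant_eq_prod_eval H', norm_mul, norm_mul, hnorm, hnorm,
    Multiset.map_congr rfl fun z hz => H'.norm_evalAt_eq (H.mem_of_mem_roots hz)]

theorem finprod_sub_pow (H' : IsPrepared D G N Q k) (z : ℂ_[p]) (m : ℕ) :
    ∏ᶠ w ∈ zeros D G, (z - w) ^ (m * zeroMult D G w) = Q.eval z ^ m := by
  simp only [pow_mul]
  rw [H'.finprod_zeros, Multiset.prod_map_pow,
    (IsAlgClosed.splits Q).eval_eq_prod_roots_of_monic H'.monic]

theorem resultant_eq_finprod (H : IsPrepared D F n P h) (H' : IsPrepared D G N Q k) :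
    (Polynomial.C (PowerSeries.coeff n F) * P).resultant
      (Polynomial.C (PowerSeries.coeff N G) * Q) =
    PowerSeries.coeff n F ^ N * PowerSeries.coeff N G ^ n *
      ∏ᶠ z ∈ zeros D F, ∏ᶠ w ∈ zeros D G, (z - w) ^ (zeroMult D F z * zeroMult D G w) := by
  simp only [H'.finprod_sub_pow]
  rw [H.finprod_zeros, H.resultant_eq_prod_eval H']
  simp only [Polynomial.eval_C_mul, Multiset.prod_map_mul, Multiset.map_const',
    Multiset.prod_replicate, H.card_roots, mul_assoc]

theorem norm_resultant_le_max (H : IsPrepared D F n P h) (H' : IsPrepared D G N Q k)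
    (hF : HasIntegralCoeffs F) (hG : HasIntegralCoeffs G)
    (hne : ¬ (n = 0 ∧ N = 0 ∧ ‖PowerSeries.coeff n F‖ < 1 ∧ ‖PowerSeries.coeff N G‖ < 1))
    {x : ℂ_[p]} (hx : x ∈ D) (hx1 : ‖x‖ ≤ 1) :
    ‖(Polynomial.C (PowerSeries.coeff n F) * P).resultant
      (Polynomial.C (PowerSeries.coeff N G) * Q)‖ ≤ max ‖evalAt F x‖ ‖evalAt G x‖ := by
  rw [H.norm_evalAt_eq hx, H'.norm_evalAt_eq hx]
  by_cases hnN : n = 0 ∧ N = 0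
  · obtain ⟨rfl, rfl⟩ := hnN
    obtain rfl := H.monic.natDegree_eq_zero.mp H.natDegree_eq
    obtain rfl := H'.monic.natDegree_eq_zero.mp H'.natDegree_eq
    rw [H.resultant_eq_prod_eval H']
    simp only [pow_zero, Polynomial.roots_one, Multiset.empty_eq_zero, Multiset.map_zero,
      Multiset.prod_zero, mul_one, norm_one, Polynomial.eval_C]
    by_contra! hlt
    exact hne ⟨rfl, rfl, max_lt_iff.mp hlt⟩
  · refine norm_resultant_le (H.norm_coeff_C_mul_le hF) (H'.norm_coeff_C_mul_le hG) ?_ hx1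
    rwa [H.natDegree_C_mul, H'.natDegree_C_mul, ← not_and_or]

theorem resultantComparison (hD : D ⊆ closedDisc p) (H : IsPrepared D F n P h)
    (H' : IsPrepared D G N Q k) :
    ResultantComparison D n N F G (discResultant D n N F G)
      (Polynomial.C (PowerSeries.coeff n F) * P) (Polynomial.C (PowerSeries.coeff N G) * Q) := by
  refine ⟨vp_eq_vp_of_norm_eq (H.norm_discResultant H'), H.resultant_eq_finprod H', ?_,
    fun hF hG hne => iSup₂_le fun x hx =>
      min_vp_le_vp (H.norm_resultant_le_max H' hF hG hne hx (hD hx))⟩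
  rw [Polynomial.resultant, H.natDegree_C_mul, H'.natDegree_C_mul]

end IsPrepared

end Prepared

section Distinguished

variable {F : PowerSeries ℂ_[p]} {n : ℕ} {P : Polynomial ℂ_[p]}

theorem IsDistinguishedO.isPrepared (hP : IsDistinguishedO F n P)
    (hn : PowerSeries.coeff n F ≠ 0) : ∃ h, IsPrepared (openDisc p) F n P h := by
  obtain ⟨hmonic, rfl, hlt, U, hU0, hU, hF⟩ := hP
  have hconv : ConvergesOn (openDisc p) U := convergesOn_openDisc hU
  refine ⟨U, hmonic, rfl, hn, fun i => ?_, fun z hz => ?_, hconv, fun x hx => ?_, hF⟩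
  · rcases lt_trichotomy i P.natDegree with hi | rfl | hi
    · exact (hlt i hi).le
    · rw [hmonic.coeff_natDegree, norm_one]
    · rw [Polynomial.coeff_eq_zero_of_natDegree_lt hi, norm_zero]
      exact zero_le_one
  · by_contra hz1
    obtain ⟨i, hi, hle⟩ := exists_norm_le_norm_coeff_of_isRoot hmonic hz (not_lt.mp hz1)
    exact hz1 (hle.trans_lt (hlt i hi))
  · refine norm_evalAt_eq_one (hconv x hx) hU0 fun i hi => ?_
    rw [norm_mul, norm_pow]
    exact (mul_le_of_le_one_left (by positivity) (hU i)).trans_lt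
      (pow_lt_one₀ (norm_nonneg x) hx hi.ne')

theorem IsDistinguishedC.norm_coeff_le_one (hP : IsDistinguishedC F n P) (hn : IsLwideg F n)
    (i : ℕ) : ‖P.coeff i‖ ≤ 1 := by
  obtain ⟨-, -, h, -, h0, hlt, hF⟩ := hP
  have hh (i : ℕ) : ‖PowerSeries.coeff i h‖ ≤ 1 := by
    rcases Nat.eq_zero_or_pos i with rfl | hi
    exacts [h0.le, (hlt i hi).le]
  rw [← Polynomial.coeff_coe]
  refine norm_coeff_le_of_norm_coeff_mul_le h0 hh (fun j => ?_) i
  have hj := hn.2.1 j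
  rw [hF, mul_assoc, PowerSeries.coeff_C_mul, ← mul_assoc, ← hF, norm_mul] at hj
  exact le_of_mul_le_mul_left (by rwa [mul_one]) (norm_pos_iff.mpr hn.1)

theorem IsDistinguishedC.isPrepared (hP : IsDistinguishedC F n P) (hn : IsLwideg F n) :
    ∃ h, IsPrepared (closedDisc p) F n P h := by
  have hint := hP.norm_coeff_le_one hn
  obtain ⟨hmonic, hdeg, h, hconv, h0, hlt, hF⟩ := hP
  refine ⟨h, hmonic, hdeg, hn.1, hint, fun z hz => ?_, hconv, fun x hx => ?_, hF⟩
  · by_contra hz1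
    obtain ⟨i, -, hle⟩ := exists_norm_le_norm_coeff_of_isRoot hmonic hz (not_le.mp hz1).le
    exact hz1 (hle.trans (hint i))
  · refine norm_evalAt_eq_one (hconv x hx) h0 fun i hi => ?_
    rw [norm_mul, norm_pow]
    exact (mul_le_of_le_one_right (norm_nonneg _) (pow_le_one₀ (norm_nonneg x) hx)).trans_lt
      (hlt i hi)

end Distinguished

section Existence

/-- The coefficients of `F` of index less than `n`, the point at which the formal variables
`f_0, …, f_{n-1}` are evaluated. -/
def lowerCoeffs (n : ℕ) (F : PowerSeries ℂ_[p]) (i : Fin n) : ℂ_[p] := PowerSeries.coeff (i : ℕ) F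

theorem mvEvalSeries_genericSeries_lowerCoeffs (n : ℕ) (F : PowerSeries ℂ_[p]) :
    mvEvalSeries (lowerCoeffs n F) (genericSeries n fun k => PowerSeries.coeff (n + k) F) = F := by
  ext i
  rw [mvEvalSeries, PowerSeries.coeff_mk]
  rcases lt_or_ge i n with hi | hi
  · rw [coeff_genericSeries_of_lt _ hi, mvEval_X, lowerCoeffs]
  · obtain ⟨k, rfl⟩ := Nat.exists_eq_add_of_le hi
    rw [coeff_add_genericSeries, mvEval_C]

/-- The gauge `ω` controls the coefficients of `F` well enough for a Weierstrass factorisation of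
the generic series to be evaluated at them. -/
structure IsGaugedBy (ω : ℤ → ℝ) (F : PowerSeries ℂ_[p]) (n : ℕ) : Prop where
  isGauge : IsGauge ω
  isTame : IsTame ω (lowerCoeffs n F)
  norm_coeff_eq_one : ‖PowerSeries.coeff n F‖ = 1
  norm_coeff_add_le : ∀ k : ℕ, ‖PowerSeries.coeff (n + k) F‖ ≤ ω k

variable {F G : PowerSeries ℂ_[p]} {n N : ℕ}

theorem IsGaugedBy.exists_eq_mul {ω : ℤ → ℝ} (hF : IsGaugedBy ω F n)
    (d : WeierstrassFactorization n fun k => PowerSeries.coeff (n + k) F) :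
    ∃ U : PowerSeries ℂ_[p], ‖PowerSeries.coeff 0 U‖ = 1 ∧
      (∀ k : ℕ, ‖PowerSeries.coeff k U‖ ≤ ω k) ∧
      F = PowerSeries.C (PowerSeries.coeff n F) *
        (mvEvalPoly (lowerCoeffs n F) d.poly : PowerSeries ℂ_[p]) * U := by
  obtain ⟨hω, hx, h1, hle⟩ := hF
  have hmul := d.mvEvalPoly_mul_mvEvalSeries_unit hω h1 hle hx
  rw [mvEvalSeries_genericSeries_lowerCoeffs] at hmul
  have hinv : PowerSeries.C (PowerSeries.coeff n F) * PowerSeries.C (PowerSeries.coeff n F)⁻¹ =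
      1 := by
    rw [← map_mul, mul_inv_cancel₀ (norm_ne_zero_iff.mp (h1 ▸ one_ne_zero)), map_one]
  have hnorm (k : ℕ) : ‖PowerSeries.coeff k (PowerSeries.C (PowerSeries.coeff n F)⁻¹ *
      mvEvalSeries (lowerCoeffs n F) d.unit)‖ =
      ‖mvEval (lowerCoeffs n F) (PowerSeries.coeff k d.unit)‖ := by
    rw [PowerSeries.coeff_C_mul, norm_mul, norm_inv, h1, inv_one, one_mul, mvEvalSeries,
      PowerSeries.coeff_mk]
  refine ⟨_, (hnorm 0).trans (d.norm_mvEval_coeff_zero_unit hω h1 hle hx), fun k => ?_, ?_⟩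
  · exact (hnorm k).trans_le ((d.seriesBounded_unit hω h1 hle).norm_mvEval_coeff_le hω hx k)
  · rw [mul_mul_mul_comm, hinv, one_mul, hmul]

theorem IsWideg.exists_isGaugedBy (hF : IsWideg F n) (hF1 : ‖PowerSeries.coeff n F‖ = 1)
    (hG : IsWideg G N) :
    ∃ ω c, IsGaugedBy ω F n ∧ ∀ k : ℕ, ‖PowerSeries.coeff k G‖ ≤ c * ω k := by
  have hone (k : ℕ) : powerGauge 1 1 k = 1 := by rw [powerGauge_natCast, one_pow, max_self]
  have hω : IsGauge (powerGauge 1 1) :=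
    isGauge_powerGauge zero_le_one le_rfl zero_le_one le_rfl
  refine ⟨powerGauge 1 1, ‖PowerSeries.coeff N G‖, ⟨hω, ?_, hF1, fun k => ?_⟩, fun k => ?_⟩
  · exact hω.isTame_of_norm_lt_one fun i => hF1 ▸ hF.2.2 i i.2
  · rw [hone, ← hF1]
    exact hF.2.1 _
  · rw [hone, mul_one]
    exact hG.2.1 k

theorem IsLwideg.exists_isGaugedBy (hF : IsLwideg F n) (hF1 : ‖PowerSeries.coeff n F‖ = 1)
    (hFc : ConvergesOn (closedDisc p) F) (hG : IsLwideg G N) (hGc : ConvergesOn (closedDisc p) G) :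
    ∃ ω c, IsGaugedBy ω F n ∧ (∀ w > 0, ω w < 1) ∧ Tendsto ω atTop (𝓝 0) ∧
      ∀ k : ℕ, ‖PowerSeries.coeff k G‖ ≤ c * ω k := by
  set c := ‖PowerSeries.coeff N G‖ + 1
  have hc : 0 < c := by positivity
  have hG1 (k : ℕ) : ‖PowerSeries.coeff k G‖ / c < 1 :=
    (div_lt_one hc).mpr ((hG.2.1 k).trans_lt (lt_add_one _))
  have hlim : Tendsto (fun k => max ‖PowerSeries.coeff (n + k) F‖ (‖PowerSeries.coeff k G‖ / c))
      atTop (𝓝 0) := by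
    have hFlim := (convergesOn_closedDisc_iff.mp hFc).comp (tendsto_add_atTop_nat n)
    have hGlim := (convergesOn_closedDisc_iff.mp hGc).div_const c
    simpa [Function.comp_def, add_comm] using hFlim.max hGlim
  obtain ⟨ω, hω, hle, hlt, h0⟩ := exists_isGauge_ge (max_le hF1.le (hG1 0).le)
    (fun k hk => max_lt (hF1 ▸ hF.2.2 (n + k) (by omega)) (hG1 k)) hlim
  exact ⟨ω, c, ⟨hω, hω.isTame_of_tendsto h0 fun i => hF1 ▸ hF.2.1 i, hF1,
    fun k => (le_max_left _ _).trans (hle k)⟩, hlt, h0,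
    fun k => (div_le_iff₀' hc).mp ((le_max_right _ _).trans (hle k))⟩

theorem IsWideg.isDistinguishedO (hF : IsWideg F n) (hF1 : ‖PowerSeries.coeff n F‖ = 1)
    (d : WeierstrassFactorization n fun k => PowerSeries.coeff (n + k) F) :
    IsDistinguishedO F n (mvEvalPoly (lowerCoeffs n F) d.poly) := by
  obtain ⟨ω, c, hω, -⟩ := hF.exists_isGaugedBy hF1 hF
  obtain ⟨U, hU0, hU, hFU⟩ := hω.exists_eq_mul d
  have hmonic := isMonicOfDegree_mvEvalPoly (lowerCoeffs n F) d.isMonicOfDegree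
  have hlower : ‖lowerCoeffs n F‖ < 1 :=
    (pi_norm_lt_iff one_pos).mpr fun i => hF1 ▸ hF.2.2 i i.2
  exact ⟨hmonic.monic, hmonic.natDegree_eq, fun i hi =>
    (d.norm_coeff_mvEvalPoly_le hω.isGauge hF1 hω.norm_coeff_add_le hlower.le
      (norm_le_pi_norm _) hi).trans_lt hlower,
    U, hU0, fun k => (hU k).trans (hω.isGauge.le_one _), hFU⟩

theorem IsLwideg.isDistinguishedC (hF : IsLwideg F n) (hF1 : ‖PowerSeries.coeff n F‖ = 1)
    (hFc : ConvergesOn (closedDisc p) F)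
    (d : WeierstrassFactorization n fun k => PowerSeries.coeff (n + k) F) :
    IsDistinguishedC F n (mvEvalPoly (lowerCoeffs n F) d.poly) := by
  obtain ⟨ω, c, hω, hlt, h0, -⟩ := hF.exists_isGaugedBy hF1 hFc hF hFc
  obtain ⟨U, hU0, hU, hFU⟩ := hω.exists_eq_mul d
  have hmonic := isMonicOfDegree_mvEvalPoly (lowerCoeffs n F) d.isMonicOfDegree
  refine ⟨hmonic.monic, hmonic.natDegree_eq, U, convergesOn_closedDisc_iff.mpr ?_, hU0,
    fun i hi => (hU i).trans_lt (hlt _ (by omega)), hFU⟩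
  exact squeeze_zero (fun _ => norm_nonneg _) hU (h0.comp tendsto_natCast_atTop_atTop)

end Existence

section Scaling

variable {F : PowerSeries ℂ_[p]} {n : ℕ} {P : Polynomial ℂ_[p]} {a : ℂ_[p]}

theorem IsWideg.C_mul (hF : IsWideg F n) (ha : a ≠ 0) : IsWideg (PowerSeries.C a * F) n := by
  have h := norm_pos_iff.mpr ha
  simp only [IsWideg, PowerSeries.coeff_C_mul, norm_mul]
  exact ⟨mul_ne_zero ha hF.1, fun i => mul_le_mul_of_nonneg_left (hF.2.1 i) h.le,
    fun i hi => mul_lt_mul_of_pos_left (hF.2.2 i hi) h⟩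

theorem IsLwideg.C_mul (hF : IsLwideg F n) (ha : a ≠ 0) : IsLwideg (PowerSeries.C a * F) n := by
  have h := norm_pos_iff.mpr ha
  simp only [IsLwideg, PowerSeries.coeff_C_mul, norm_mul]
  exact ⟨mul_ne_zero ha hF.1, fun i => mul_le_mul_of_nonneg_left (hF.2.1 i) h.le,
    fun i hi => mul_lt_mul_of_pos_left (hF.2.2 i hi) h⟩

theorem eq_C_mul_mul_of_C_mul_eq {S U : PowerSeries ℂ_[p]} (ha : a ≠ 0)
    (h : PowerSeries.C a * F =
      PowerSeries.C (PowerSeries.coeff n (PowerSeries.C a * F)) * S * U) :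
    F = PowerSeries.C (PowerSeries.coeff n F) * S * U := by
  have hC : (PowerSeries.C a : PowerSeries ℂ_[p]) ≠ 0 := by
    rwa [ne_eq, map_eq_zero_iff _ PowerSeries.C_injective]
  refine mul_left_cancel₀ hC ?_
  rw [h, PowerSeries.coeff_C_mul, map_mul]
  ring

theorem IsDistinguishedO.of_C_mul (ha : a ≠ 0) (hP : IsDistinguishedO (PowerSeries.C a * F) n P) :
    IsDistinguishedO F n P := by
  obtain ⟨hmonic, hdeg, hlt, U, hU0, hU, hF⟩ := hP
  exact ⟨hmonic, hdeg, hlt, U, hU0, hU, eq_C_mul_mul_of_C_mul_eq ha hF⟩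

theorem IsDistinguishedC.of_C_mul (ha : a ≠ 0) (hP : IsDistinguishedC (PowerSeries.C a * F) n P) :
    IsDistinguishedC F n P := by
  obtain ⟨hmonic, hdeg, h, hconv, h0, hlt, hF⟩ := hP
  exact ⟨hmonic, hdeg, h, hconv, h0, hlt, eq_C_mul_mul_of_C_mul_eq ha hF⟩

theorem exists_C_mul_coeff_eq_one (hn : PowerSeries.coeff n F ≠ 0) :
    ∃ a : ℂ_[p], a ≠ 0 ∧ PowerSeries.coeff n (PowerSeries.C a * F) = 1 :=
  ⟨_, inv_ne_zero hn, by rw [PowerSeries.coeff_C_mul, inv_mul_cancel₀ hn]⟩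

theorem IsWideg.exists_isDistinguishedO (hF : IsWideg F n) : ∃ P, IsDistinguishedO F n P := by
  obtain ⟨a, ha, h1⟩ := exists_C_mul_coeff_eq_one hF.1
  obtain ⟨d⟩ := WeierstrassFactorization.nonempty n
    (f := fun k => PowerSeries.coeff (n + k) (PowerSeries.C a * F)) (h1 ▸ isUnit_one)
  exact ⟨_, ((hF.C_mul ha).isDistinguishedO (by rw [h1, norm_one]) d).of_C_mul ha⟩

theorem IsLwideg.exists_isDistinguishedC (hF : IsLwideg F n) (hFc : ConvergesOn (closedDisc p) F) :
    ∃ P, IsDistinguishedC F n P := by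
  obtain ⟨a, ha, h1⟩ := exists_C_mul_coeff_eq_one hF.1
  obtain ⟨d⟩ := WeierstrassFactorization.nonempty n
    (f := fun k => PowerSeries.coeff (n + k) (PowerSeries.C a * F)) (h1 ▸ isUnit_one)
  have hconv : ConvergesOn (closedDisc p) (PowerSeries.C a * F) := by
    rw [← Polynomial.coe_C]
    exact hFc.coe_mul _
  exact ⟨_, ((hF.C_mul ha).isDistinguishedC (by rw [h1, norm_one]) hconv d).of_C_mul ha⟩

end Scaling

section Universal

/-- The variables `f_n, f_{n+1}, …` of the coefficient ring, `univF n k` standing for `f_{n+k}`. -/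
def univF (n k : ℕ) : UnivCoeff n :=
  algebraMap (MvPolynomial ({k : ℕ // n ≤ k} ⊕ ℕ) ℤ) (UnivCoeff n)
    (MvPolynomial.X (Sum.inl ⟨n + k, n.le_add_right k⟩))

/-- The variables `g_0, g_1, …` of the coefficient ring. -/
def univG (n k : ℕ) : UnivCoeff n :=
  algebraMap (MvPolynomial ({k : ℕ // n ≤ k} ⊕ ℕ) ℤ) (UnivCoeff n) (MvPolynomial.X (Sum.inr k))

instance nontrivial_univCoeff (n : ℕ) : Nontrivial (UnivCoeff n) :=
  (IsLocalization.isDomain_localization (powers_le_nonZeroDivisors_of_noZeroDivisors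
    (MvPolynomial.X_ne_zero _))).toNontrivial

theorem isUnit_univF_zero (n : ℕ) : IsUnit (univF n 0) :=
  IsLocalization.Away.algebraMap_isUnit _

/-- A Weierstrass factorisation of the generic series with all its coefficients indeterminate. -/
def univFactorization (n : ℕ) : WeierstrassFactorization n (univF n) :=
  (WeierstrassFactorization.nonempty n (isUnit_univF_zero n)).some

/-- The universal formula for the resultant on either disc of series of degrees `n` and `N`. -/
def univResultant (n N : ℕ) : MvPowerSeries (Fin n) (UnivCoeff n) :=
  (univFactorization n).resultantSeries (univG n) N

variable {F : PowerSeries ℂ_[p]} {n : ℕ} (G : PowerSeries ℂ_[p])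
  (hn : PowerSeries.coeff n F ≠ 0)

theorem specialize_algebraMap (q : MvPolynomial ({k : ℕ // n ≤ k} ⊕ ℕ) ℤ) :
    specialize n F G hn (algebraMap _ (UnivCoeff n) q) = specializePoly n F G q :=
  IsLocalization.Away.lift_eq _ (by simpa [specializePoly] using hn) q

theorem specialize_univF :
    (fun k => specialize n F G hn (univF n k)) = fun k => PowerSeries.coeff (n + k) F := by
  ext1 k
  rw [univF, specialize_algebraMap]
  simp [specializePoly]

theorem specialize_univG :
    (fun k => specialize n F G hn (univG n k)) = fun k => PowerSeries.coeff k G := by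
  ext1 k
  rw [univG, specialize_algebraMap]
  simp [specializePoly]

theorem exists_resultantSeries_eq_map_univResultant (N : ℕ) :
    ∃ d : WeierstrassFactorization n fun k => PowerSeries.coeff (n + k) F,
      d.resultantSeries (fun k => PowerSeries.coeff k G) N =
        MvPowerSeries.map (specialize n F G hn) (univResultant n N) := by
  rw [← specialize_univF G hn, ← specialize_univG G hn]
  exact ⟨_, (univFactorization n).resultantSeries_map (specialize n F G hn) (univG n) N⟩

variable {G} {N : ℕ}

theorem IsGaugedBy.hasUnivValue {ω : ℤ → ℝ} (hω : IsGaugedBy ω F n) {c : ℝ}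
    (hG : ∀ k : ℕ, ‖PowerSeries.coeff k G‖ ≤ c * ω k) {D : Set ℂ_[p]}
    (hprep : ∀ d : WeierstrassFactorization n fun k => PowerSeries.coeff (n + k) F,
      ∃ h, IsPrepared D F n (mvEvalPoly (lowerCoeffs n F) d.poly) h) :
    HasUnivValue n (univResultant n N) F G hn (discResultant D n N F G) := by
  obtain ⟨d, hd⟩ := exists_resultantSeries_eq_map_univResultant G hn N
  obtain ⟨h, H⟩ := hprep d
  have hsum := d.hasSum_resultantSeries hω.isGauge hω.norm_coeff_eq_one hω.norm_coeff_add_le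
    hω.isTame hG N
  rw [hd] at hsum
  rw [H.discResultant_eq]
  exact hsum

theorem IsWideg.hasUnivValue (hF : IsWideg F n) (hF1 : ‖PowerSeries.coeff n F‖ = 1)
    (hG : IsWideg G N) :
    HasUnivValue n (univResultant n N) F G hF.1 (resO n N F G) := by
  obtain ⟨ω, c, hω, hGω⟩ := hF.exists_isGaugedBy hF1 hG
  exact hω.hasUnivValue hF.1 hGω fun d => (hF.isDistinguishedO hF1 d).isPrepared hF.1

theorem IsLwideg.hasUnivValue (hF : IsLwideg F n) (hF1 : ‖PowerSeries.coeff n F‖ = 1)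
    (hFc : ConvergesOn (closedDisc p) F) (hG : IsLwideg G N) (hGc : ConvergesOn (closedDisc p) G) :
    HasUnivValue n (univResultant n N) F G hF.1 (resC n N F G) := by
  obtain ⟨ω, c, hω, -, -, hGω⟩ := hF.exists_isGaugedBy hF1 hFc hG hGc
  exact hω.hasUnivValue hF.1 hGω fun d => (hF.isDistinguishedC hF1 hFc d).isPrepared hF

end Universal

end PadicResultant

end

theorem theorem2p1 (p : ℕ) [Fact p.Prime] :
    -- the open unit disc: existence and comparison with the distinguished polynomials
    (∀ (F G : PowerSeries ℂ_[p]) (n N : ℕ),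
      ConvergesOn (openDisc p) F → ConvergesOn (openDisc p) G → IsWideg F n → IsWideg G N →
      ResultantExists (openDisc p) n F G ∧
      (∃ P, IsDistinguishedO F n P) ∧ (∃ Q, IsDistinguishedO G N Q) ∧
      ∀ P Q : Polynomial ℂ_[p], IsDistinguishedO F n P → IsDistinguishedO G N Q →
        ResultantComparison (openDisc p) n N F G (resO n N F G)
          (Polynomial.C (PowerSeries.coeff n F) * P)
          (Polynomial.C (PowerSeries.coeff N G) * Q)) ∧
    -- the open unit disc: the universal power series
    (∀ n N : ℕ, ∃ Φ : MvPowerSeries (Fin n) (UnivCoeff n),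
      ∀ F G : PowerSeries ℂ_[p],
      ConvergesOn (openDisc p) F → ConvergesOn (openDisc p) G →
      ∀ (hF : IsWideg F n), IsWideg G N → ‖PowerSeries.coeff n F‖ = 1 →
        HasUnivValue n Φ F G hF.1 (resO n N F G)) ∧
    -- the closed unit disc: the degree is finite
    (∀ F : PowerSeries ℂ_[p], F ≠ 0 → ConvergesOn (closedDisc p) F → ∃ m, IsLwideg F m) ∧
    -- the closed unit disc: existence and comparison with the distinguished polynomials
    (∀ (F G : PowerSeries ℂ_[p]) (m M : ℕ),
      ConvergesOn (closedDisc p) F → ConvergesOn (closedDisc p) G →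
      IsLwideg F m → IsLwideg G M →
      ResultantExists (closedDisc p) m F G ∧
      (∃ P, IsDistinguishedC F m P) ∧ (∃ Q, IsDistinguishedC G M Q) ∧
      ∀ P Q : Polynomial ℂ_[p], IsDistinguishedC F m P → IsDistinguishedC G M Q →
        ResultantComparison (closedDisc p) m M F G (resC m M F G)
          (Polynomial.C (PowerSeries.coeff m F) * P)
          (Polynomial.C (PowerSeries.coeff M G) * Q)) ∧
    -- the closed unit disc: the universal power series
    (∀ m M : ℕ, ∃ Φ : MvPowerSeries (Fin m) (UnivCoeff m),
      ∀ F G : PowerSeries ℂ_[p],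
      ConvergesOn (closedDisc p) F → ConvergesOn (closedDisc p) G →
      ∀ (hF : IsLwideg F m), IsLwideg G M → ‖PowerSeries.coeff m F‖ = 1 →
        HasUnivValue m Φ F G hF.1 (resC m M F G)) := by
  refine ⟨fun F G n N _ hGc hF hG => ?_,
    fun n N => ⟨univResultant n N, fun F G _ _ hF hG hF1 => hF.hasUnivValue hF1 hG⟩,
    fun F hF hFc => exists_isLwideg hF hFc, fun F G m M hFc hGc hF hG => ?_,
    fun m M => ⟨univResultant m M, fun F G hFc hGc hF hG hF1 => hF.hasUnivValue hF1 hFc hG hGc⟩⟩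
  · obtain ⟨P₀, hP₀⟩ := hF.exists_isDistinguishedO
    obtain ⟨h₀, H₀⟩ := hP₀.isPrepared hF.1
    refine ⟨H₀.resultantExists hGc, ⟨P₀, hP₀⟩, hG.exists_isDistinguishedO, fun P Q hP hQ => ?_⟩
    obtain ⟨h, H⟩ := hP.isPrepared hF.1
    obtain ⟨k, H'⟩ := hQ.isPrepared hG.1
    exact H.resultantComparison openDisc_subset_closedDisc H'
  · obtain ⟨P₀, hP₀⟩ := hF.exists_isDistinguishedC hFc
    obtain ⟨h₀, H₀⟩ := hP₀.isPrepared hF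
    refine ⟨H₀.resultantExists hGc, ⟨P₀, hP₀⟩, hG.exists_isDistinguishedC hGc, fun P Q hP hQ => ?_⟩
    obtain ⟨h, H⟩ := hP.isPrepared hF
    obtain ⟨k, H'⟩ := hQ.isPrepared hG
    exact H.resultantComparison subset_rfl H'
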